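/- **Setting.** Locations are points of the plane; $x\angle\theta$ is the point with polar coordinates $(x,\theta)$ and $\angle\mathbf u$ is the angle of $\mathbf u$. Secondary transmitters $\{\mathbf X_{i}\}$ form a homogeneous Poisson point process $\Phi_{\mathrm s}$ of density $\lambda_{\mathrm s}>0$; the beam of transmitter $i$ has orientation $\omega_{i}$, uniform on $[0,2\pi)$, and its receiver is $\mathbf Y_{i}=\mathbf X_{i}+r_{\mathrm s}\angle\omega_{i}$. Power fading coefficients are exponential with mean one (Rayleigh fading): $F_{i}$ on the secondary link $i$, $G_i$ from secondary transmitter $i$ to the primary receiver, $G'_i$ from the primary transmitter to secondary receiver $i$, and $G''_{ij}$ from secondary transmitter $i$ to secondary receiver $j$. All orientations and fading coefficients are independent of each other and of $\Phi_{\mathrm s}$. The beam patterns $g_{\mathrm{pt}},g_{\mathrm{pr}},g_{\mathrm{st}},g_{\mathrm{sr}}$ of the primary transmitter and receiver and of the secondary transmitters and receivers are nonnegative and $2\pi$-periodic, with $g_{\mathrm{st}}(0),g_{\mathrm{sr}}(0)>0$. Let $\alpha>0$ be the path-loss exponent, $p_{\mathrm p},p_{\mathrm s}>0$ the transmit powers,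 $\sigma^2\ge 0$ the noise power, $\rho>0$ the transmit-restriction threshold, $\tau>0$ the SINR threshold and $r_{\mathrm s},r_{\mathrm p}>0$ the link lengths. The typical secondary link (the typical point $\mathbf X_0$ of $\Phi_{\mathrm s}$, in the sense of Palm probability) is viewed in coordinates in which its receiver is at the origin and its transmitter is at $r_{\mathrm s}\angle 0$, so that $\omega_0=\pi$. In these coordinates the primary transmitter is at $\mathbf X_{\mathrm p}=x_{\mathrm p}\angle\delta_{\mathrm p}$ with $x_{\mathrm p}>0$, and the primary receiver is at $\mathbf Y_{\mathrm p}=\mathbf X_{\mathrm p}+r_{\mathrm p}\angle\omega_{\mathrm p}\neq r_{\mathrm s}\angle 0$. For the transmitter $\mathbf X_i=x_i\angle\theta_i$ put $z_i=\|\mathbf X_i-\mathbf Y_{\mathrm p}\|$ and $\beta_i=\angle(\mathbf X_i-\mathbf Y_{\mathrm p})$. Transmitter $i$ is active ($U_i=1$, otherwise $U_i=0$) if and only if $$p_{\mathrm s}G_i\,g_{\mathrm{st}}(\beta_i-\omega_i)\,g_{\mathrm{pr}}(\omega_{\mathrm p}-\beta_i)\,z_i^{-\alpha}<\rho .$$ The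 SINR of the typical link is $$\mathsf{SINR}_0=\frac{F_0U_0\,p_{\mathrm s}g_{\mathrm{st}}(0)g_{\mathrm{sr}}(0)r_{\mathrm s}^{-\alpha}}{\sigma^2+I_{\mathrm p}+I_{\mathrm s}},\qquad I_{\mathrm p}=G'_0\,p_{\mathrm p}\,g_{\mathrm{sr}}(\delta_{\mathrm p})\,g_{\mathrm{pt}}(\delta_{\mathrm p}-\pi-\omega_{\mathrm p})\,x_{\mathrm p}^{-\alpha},$$ $$I_{\mathrm s}=\sum_{\mathbf X_i\in\Phi_{\mathrm s}\setminus\{\mathbf X_0\}}U_i\,G''_{i0}\,p_{\mathrm s}\,g_{\mathrm{sr}}(\theta_i)\,g_{\mathrm{st}}(\theta_i-\pi-\omega_i)\,x_i^{-\alpha}.$$ **Theorem.** The coverage probability $p_{\mathrm{cs}}(\tau,\rho)=\mathbb P[\mathsf{SINR}_0>\tau]$ of the typical secondary link is $$p_{\mathrm{cs}}(\tau,\rho)=\exp\!\Big(-\frac{\tau\sigma^2}{A_0}\Big)\,\frac{1-e^{-1/A_1}}{1+\tau A_2/A_0}\,\exp\!\Big(-\lambda_{\mathrm s}\int_0^{2\pi}\!\!\int_0^\infty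 \mathbb E_{\omega_{\mathrm s}}\Big[\frac{1-e^{-A_{\mathrm s}z_{\mathrm s}^{\alpha}}}{1+C_{\mathrm s}x_{\mathrm s}^{\alpha}}\Big]x_{\mathrm s}\,\mathrm dx_{\mathrm s}\,\mathrm d\theta_{\mathrm s}\Big),$$ where $\omega_{\mathrm s}$ is uniform on $[0,2\pi)$, $z_{\mathrm s}=\|x_{\mathrm s}\angle\theta_{\mathrm s}-\mathbf Y_{\mathrm p}\|$, $\beta_{\mathrm s}=\angle(x_{\mathrm s}\angle\theta_{\mathrm s}-\mathbf Y_{\mathrm p})$, $z_{\mathrm s0}=\|r_{\mathrm s}\angle0-\mathbf Y_{\mathrm p}\|$, $\beta_{\mathrm s0}=\angle(r_{\mathrm s}\angle0-\mathbf Y_{\mathrm p})$ and $$A_0=p_{\mathrm s}g_{\mathrm{sr}}(0)g_{\mathrm{st}}(0)r_{\mathrm s}^{-\alpha},\qquad A_1=\frac{p_{\mathrm s}\,g_{\mathrm{st}}(\beta_{\mathrm s0}-\pi)\,g_{\mathrm{pr}}(\omega_{\mathrm p}-\beta_{\mathrm s0})\,z_{\mathrm s0}^{-\alpha}}{\rho},\qquad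 A_2=p_{\mathrm p}\,g_{\mathrm{pt}}(\delta_{\mathrm p}-\pi-\omega_{\mathrm p})\,g_{\mathrm{sr}}(\delta_{\mathrm p})\,x_{\mathrm p}^{-\alpha},$$ $$A_{\mathrm s}=\frac{\rho}{p_{\mathrm s}\,g_{\mathrm{st}}(\beta_{\mathrm s}-\omega_{\mathrm s})\,g_{\mathrm{pr}}(\omega_{\mathrm p}-\beta_{\mathrm s})},\qquad C_{\mathrm s}=\frac{A_0}{\tau\,p_{\mathrm s}\,g_{\mathrm{st}}(\theta_{\mathrm s}-\omega_{\mathrm s}-\pi)\,g_{\mathrm{sr}}(\theta_{\mathrm s})}.$$ If a gain vanishes, a quotient with denominator $0$ is read as $\infty$, and $e^{-\infty}=0$, $1/\infty=0$. -/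

import Mathlib

open MeasureTheory ProbabilityTheory
open scoped ENNReal

namespace CognitiveNetwork

noncomputable section

/-! ### The secondary network: marked Poisson process of transmitter locations

The plane is identified with `ℂ`; the location `x ∠ θ` is `x * exp (θ * I)` and `∠ w` is `arg w`. -/

/-- The number of points of the sequence `X` that lie in `A`. -/
def pointCount {Ω : Type*} (X : ℕ → Ω → ℂ) (A : Set ℂ) (w : Ω) : ℕ∞ :=
  Set.encard {i : ℕ | X i w ∈ A}

/-- `(X i)` enumerates a homogeneous Poisson point process of density `lam` in the plane: the number
of points in a set of finite area is Poisson with mean `lam * area`, and the numbers of points in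
disjoint sets are independent. -/
structure IsHomogeneousPPP {Ω : Type*} [MeasurableSpace Ω] (P : Measure Ω) (X : ℕ → Ω → ℂ)
    (lam : ℝ) : Prop where
  measurable : ∀ i, Measurable (X i)
  poisson : ∀ A : Set ℂ, MeasurableSet A → volume A < ∞ → ∀ k : ℕ,
    P {w | pointCount X A w = (k : ℕ∞)} =
      ENNReal.ofReal (Real.exp (-(lam * (volume A).toReal)) *
        (lam * (volume A).toReal) ^ k / (k.factorial : ℝ))
  indep : ∀ (n : ℕ) (A : Fin n → Set ℂ), (∀ k, MeasurableSet (A k)) → (∀ k, volume (A k) < ∞) →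
    Pairwise (fun k l => Disjoint (A k) (A l)) →
    iIndepFun (fun k => pointCount X (A k)) P

/-- Labels of the scalar random variables attached to the secondary links. -/
inductive Mark : Type
  /-- beam orientation of link `i` (direction from its transmitter to its receiver) -/
  | orientation (i : ℕ)
  /-- fading of secondary link `i` itself -/
  | own (i : ℕ)
  /-- fading from secondary transmitter `i` to the primary receiver -/
  | toPrimary (i : ℕ)
  /-- fading from the primary transmitter to secondary receiver `j` -/
  | fromPrimary (j : ℕ)
  /-- fading from secondary transmitter `i` to secondary receiver `j` -/
  | cross (i j : ℕ)

/-- The uniform distribution of an angle on `[0, 2π)`. -/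
def uniformAngle : Measure ℝ := ProbabilityTheory.cond volume (Set.Ico 0 (2 * Real.pi))

/-- The law of each mark: orientations are uniform, the power fading coefficients are exponential
with mean one (Rayleigh fading). -/
def markLaw : Mark → Measure ℝ
  | .orientation _ => uniformAngle
  | .own _ => expMeasure 1
  | .toPrimary _ => expMeasure 1
  | .fromPrimary _ => expMeasure 1
  | .cross _ _ => expMeasure 1

/-- The probabilistic model of the secondary network: the transmitters form a homogeneous Poisson
point process, and all marks are mutually independent, independent of the locations, and have the
prescribed laws. -/
structure IsSecondaryNetwork {Ω : Type*} [MeasurableSpace Ω] (P : Measure Ω) (X : ℕ → Ω → ℂ)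
    (mark : Mark → Ω → ℝ) (lam : ℝ) : Prop where
  locations : IsHomogeneousPPP P X lam
  law : ∀ m, HasLaw (mark m) (markLaw m) P
  indep_marks : iIndepFun mark P
  indep_locations : IndepFun (fun w i => X i w) (fun w m => mark m w) P

/-! ### System parameters and the geometry relative to a typical secondary link -/

/-- A beam pattern: a nonnegative measurable gain as a function of the angle from the beam
orientation, extended `2π`-periodically from `[-π, π)` to all real angles. -/
structure IsBeamPattern (g : ℝ → ℝ) : Prop where
  measurable : Measurable g
  nonneg : ∀ t, 0 ≤ g t
  periodic : Function.Periodic g (2 * Real.pi)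

/-- The deterministic parameters. -/
structure Params where
  /-- path-loss exponent -/
  α : ℝ
  /-- transmit power of the primary transmitter -/
  pp : ℝ
  /-- transmit power of the secondary transmitters -/
  ps : ℝ
  /-- the thermal noise power is `σ ^ 2` -/
  σ : ℝ
  /-- transmit-restriction threshold -/
  ρ : ℝ
  /-- length of the secondary links -/
  rs : ℝ
  /-- length of the primary link -/
  rp : ℝ
  /-- distance of the primary transmitter from the typical secondary receiver -/
  xp : ℝ
  /-- angle of the primary transmitter seen from the typical secondary receiver -/
  δp : ℝ
  /-- orientation of the primary link (direction from its transmitter to its receiver) -/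
  ωp : ℝ
  /-- beam pattern of the primary transmitter -/
  gpt : ℝ → ℝ
  /-- beam pattern of the primary receiver -/
  gpr : ℝ → ℝ
  /-- beam pattern of the secondary transmitters -/
  gst : ℝ → ℝ
  /-- beam pattern of the secondary receivers -/
  gsr : ℝ → ℝ

/-- The location with radial distance `x` and angle `θ`. -/
def polar (x θ : ℝ) : ℂ := (x : ℂ) * Complex.exp ((θ : ℂ) * Complex.I)

namespace Params

variable (S : Params)

/-- Location of the primary transmitter. In this and the following definitions, the typical
secondary receiver is at the origin and its transmitter is at `rs ∠ 0`. -/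
def primaryTx : ℂ := polar S.xp S.δp

/-- Location of the primary receiver. -/
def primaryRx : ℂ := S.primaryTx + polar S.rp S.ωp

/-- Distance `z` between location `u` and the primary receiver. -/
def zDist (u : ℂ) : ℝ := ‖u - S.primaryRx‖

/-- The angle `β = ∠ (u - Y_p)` for location `u`. -/
def beta (u : ℂ) : ℝ := Complex.arg (u - S.primaryRx)

/-- Power received at the primary receiver from a secondary transmitter at `u` with beam
orientation `ω` and fading `G`. -/
def powerAtPrimary (u : ℂ) (ω G : ℝ) : ℝ :=
  S.ps * G * S.gst (S.beta u - ω) * S.gpr (S.ωp - S.beta u) * S.zDist u ^ (-S.α)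

open Classical in
/-- Transmission indicator of a secondary transmitter: it is active if and only if the power which
the primary receiver gets from it is below the threshold `ρ`. -/
def active (u : ℂ) (ω G : ℝ) : ℝ≥0∞ := if S.powerAtPrimary u ω G < S.ρ then 1 else 0

/-- Power received at the typical secondary receiver from a secondary transmitter at `u` with beam
orientation `ω` and fading `G`, when that transmitter is active. -/
def powerAtTypical (u : ℂ) (ω G : ℝ) : ℝ :=
  G * S.ps * S.gsr u.arg * S.gst (u.arg - Real.pi - ω) * ‖u‖ ^ (-S.α)

/-- Interference at the typical secondary receiver from the primary transmitter, for fading `G`. -/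
def primaryInterference (G : ℝ) : ℝ :=
  G * S.pp * S.gsr S.δp * S.gpt (S.δp - Real.pi - S.ωp) * ‖S.primaryTx‖ ^ (-S.α)

end Params

/-! ### The network seen from secondary link `j`, and the typical link -/

section Typical

variable {Ω : Type*} (S : Params) (X : ℕ → Ω → ℂ) (mark : Mark → Ω → ℝ)

/-- Location of secondary receiver `j`. -/
def secondaryRx (j : ℕ) (w : Ω) : ℂ := X j w + polar S.rs (mark (.orientation j) w)

/-- Location of secondary transmitter `i` in the coordinates of link `j`: the plane is moved by the
rigid motion that takes receiver `j` to the origin and transmitter `j` to `rs ∠ 0`. -/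
def relTx (j i : ℕ) (w : Ω) : ℂ :=
  (X i w - secondaryRx S X mark j w) * polar 1 (Real.pi - mark (.orientation j) w)

/-- Beam orientation of link `i` in the coordinates of link `j`. -/
def relOrientation (j i : ℕ) (w : Ω) : ℝ :=
  mark (.orientation i) w + (Real.pi - mark (.orientation j) w)

/-- Transmission indicator of link `i`, in the coordinates of link `j`. -/
def activity (j i : ℕ) (w : Ω) : ℝ≥0∞ :=
  S.active (relTx S X mark j i w) (relOrientation mark j i w) (mark (.toPrimary i) w)

/-- Total interference at receiver `j` due to all other active secondary transmitters. -/
def secondaryInterference (j : ℕ) (w : Ω) : ℝ≥0∞ :=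
  ∑' i : {i : ℕ // i ≠ j}, activity S X mark j i w *
    ENNReal.ofReal (S.powerAtTypical (relTx S X mark j i w) (relOrientation mark j i w)
      (mark (.cross i j) w))

/-- SINR of secondary link `j`, with values in `[0, ∞]`, when the primary link is at
distance `xp`, angle `δp` and orientation `ωp` in the coordinates of link `j`. -/
def SINR (j : ℕ) (w : Ω) : ℝ≥0∞ :=
  ENNReal.ofReal (mark (.own j) w * S.ps * S.gst 0 * S.gsr 0 * S.rs ^ (-S.α)) *
      activity S X mark j j w /
    (ENNReal.ofReal (S.σ ^ 2) + ENNReal.ofReal (S.primaryInterference (mark (.fromPrimary j) w)) +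
      secondaryInterference S X mark j w)

/-- Palm probability, for a stationary point process `X` of density `lam`, that the typical point
has property `E` (where `E j` is the event that the network seen from the point `j` has the
property): the mean number of points with the property in the window `B`, divided by the mean number
`lam * area B` of points in `B`. -/
def palmProb [MeasurableSpace Ω] (P : Measure Ω) (lam : ℝ) (B : Set ℂ) (E : ℕ → Set Ω) : ℝ≥0∞ :=
  (∫⁻ w, ((Set.encard {j : ℕ | X j w ∈ B ∧ w ∈ E j} : ℕ∞) : ℝ≥0∞) ∂P) /
    (ENNReal.ofReal lam * volume B)

/-- Coverage probability of the typical secondary link at SINR threshold `τ`, computed from the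
window `B`. -/
def coverageProb [MeasurableSpace Ω] (P : Measure Ω) (lam τ : ℝ) (B : Set ℂ) : ℝ≥0∞ :=
  palmProb X P lam B (fun j => {w | ENNReal.ofReal τ < SINR S X mark j w})

end Typical

/-! ### The terms of the formula

Gains may vanish, so the quotients are taken in `[0, ∞]`, with `1 / 0 = ∞` and `e ^ (-∞) = 0`. -/

/-- `e ^ (-t)` for `t ∈ [0, ∞]`. -/
def expNeg (t : ℝ≥0∞) : ℝ≥0∞ := EReal.exp (-(t : EReal))

namespace Params

variable (S : Params)

/-- Serving power of the secondary link. -/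
def A0 : ℝ := S.ps * S.gsr 0 * S.gst 0 * S.rs ^ (-S.α)

/-- Location `rs ∠ 0` of the typical secondary transmitter. -/
def typicalTx : ℂ := polar S.rs 0

/-- Interference of the typical secondary transmitter at the primary receiver, relative to `ρ`. -/
def A1 : ℝ :=
  S.ps * S.gst (S.beta S.typicalTx - Real.pi) * S.gpr (S.ωp - S.beta S.typicalTx) *
    S.zDist S.typicalTx ^ (-S.α) / S.ρ

/-- Interference of the primary transmitter at the typical secondary receiver. -/
def A2 : ℝ := S.pp * S.gpt (S.δp - Real.pi - S.ωp) * S.gsr S.δp * S.xp ^ (-S.α)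

/-- Ratio between the threshold and the directional gain from an interfering secondary transmitter
at `x ∠ θ` with orientation `ω` to the primary receiver. -/
def As (ω x θ : ℝ) : ℝ≥0∞ :=
  ENNReal.ofReal S.ρ / ENNReal.ofReal (S.ps * S.gst (S.beta (polar x θ) - ω) *
    S.gpr (S.ωp - S.beta (polar x θ)))

/-- The factor `C_s` for an interfering secondary transmitter. -/
def Cs (τ ω θ : ℝ) : ℝ≥0∞ :=
  ENNReal.ofReal S.A0 / ENNReal.ofReal (τ * S.ps * S.gst (θ - ω - Real.pi) * S.gsr θ)

/-- The integral of the exponential term of the formula, over the interfering secondary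
transmitters. -/
def interferenceIntegral (τ : ℝ) : ℝ≥0∞ :=
  ∫⁻ θ in Set.Ioo 0 (2 * Real.pi), ∫⁻ x in Set.Ioi (0 : ℝ),
    (∫⁻ ω, (1 - expNeg (S.As ω x θ * ENNReal.ofReal (S.zDist (polar x θ) ^ S.α))) /
      (1 + S.Cs τ ω θ * ENNReal.ofReal (x ^ S.α)) ∂uniformAngle) * ENNReal.ofReal x

end Params

end

end CognitiveNetwork

namespace CognitiveNetwork

open Filter Topology Finset

/-! ### The function `expNeg` -/

/-! By the definition of Palm probability, the coverage probability is the mean number of covered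
links in the window `B`, divided by `lam * volume B`. The law of locations and marks is the product
of the law of the locations and an infinite product measure (`IsSecondaryNetwork.map_eq`), so for
fixed locations the marks can be integrated out one group at a time.

For link `j`, the exponential tail of its own fading turns the event SINR > τ into the factor `U_j
exp (-(τ / A0) (σ² + I_p + I_s))`. Since `I_s` is a sum over the transmitters, this is a product
over `i`. Once the orientation `ω` of link `j` is fixed, the factors depend on disjoint, hence
independent, blocks of marks. What remains is the noise term, `linkFactor` (activity of transmitter
`j` and Laplace transform of `I_p`), and the product over `i ≠ j` of `meanAttenuation` at `placement
ω (X_i - X_j)`; this is `infinitePi_coverageEvent`.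

The sum of such products over the points in `B` is averaged with the Mecke formula
`IsHomogeneousPPP.palmProduct_translate`: its mean is `lam * volume B * exp (-lam ∫ (1 - h))`. That
formula is derived from the counts alone. For step functions it is the Poisson identity `E[N F(N -
1)] = m E[F(N)]` combined with independence of counts in disjoint cells. The passage to general
functions of the relative positions rests on `palmProduct_le`, which bounds the effect of changing
the factors by an integral against the second factorial moment measure `lam² du dv`.

A placement is a rigid motion, so the integral does not depend on `ω`. In polar coordinates, `1 -
meanAttenuation` is the probability of activity times the relative loss `1 / (1 + C_s x^α)`,
averaged over the orientation. -/

lemma expNeg_ofReal {t : ℝ} (ht : 0 ≤ t) :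
    expNeg (ENNReal.ofReal t) = ENNReal.ofReal (Real.exp (-t)) := by
  rw [expNeg, EReal.coe_ennreal_ofReal, max_eq_left ht, ← EReal.coe_neg, EReal.exp_coe]

@[simp] lemma expNeg_top : expNeg ∞ = 0 := by simp [expNeg]

@[simp] lemma expNeg_zero : expNeg 0 = 1 := by simp [expNeg]

lemma continuous_expNeg : Continuous expNeg :=
  ENNReal.continuous_exp.comp (continuous_neg.comp continuous_coe_ennreal_ereal)

lemma measurable_expNeg : Measurable expNeg := continuous_expNeg.measurable

lemma expNeg_antitone : Antitone expNeg := fun s t h => by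
  unfold expNeg
  exact EReal.exp_monotone (EReal.neg_le_neg_iff.2 (EReal.coe_ennreal_le_coe_ennreal_iff.2 h))

lemma expNeg_le_one (t : ℝ≥0∞) : expNeg t ≤ 1 := by
  simpa using expNeg_antitone (zero_le (a := t))

lemma expNeg_add (s t : ℝ≥0∞) : expNeg (s + t) = expNeg s * expNeg t := by
  rcases eq_or_ne s ∞ with rfl | hs
  · simp
  rcases eq_or_ne t ∞ with rfl | ht
  · simp
  lift s to NNReal using hs
  lift t to NNReal using ht
  have h (x : NNReal) : (x : ℝ≥0∞) = ENNReal.ofReal (x : ℝ) := (ENNReal.ofReal_coe_nnreal).symm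
  rw [h s, h t, ← ENNReal.ofReal_add s.coe_nonneg t.coe_nonneg, expNeg_ofReal (by positivity),
    expNeg_ofReal s.coe_nonneg, expNeg_ofReal t.coe_nonneg, ← ENNReal.ofReal_mul (Real.exp_pos _).le,
    ← Real.exp_add]
  congr 2
  ring

lemma expNeg_sum {ι : Type*} (s : Finset ι) (v : ι → ℝ≥0∞) :
    expNeg (∑ i ∈ s, v i) = ∏ i ∈ s, expNeg (v i) := by
  classical
  induction s using Finset.induction_on with
  | empty => simp
  | insert a s ha ih => rw [sum_insert ha, prod_insert ha, expNeg_add, ih]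

/-! ### Infinite products of numbers in `[0, 1]` -/

/-- The infinite product of a sequence in `[0, 1]`, as the infimum of the partial products. -/
noncomputable def infProd (a : ℕ → ℝ≥0∞) : ℝ≥0∞ := ⨅ n, ∏ i ∈ range n, a i

lemma antitone_prod_range {a : ℕ → ℝ≥0∞} (ha : ∀ i, a i ≤ 1) :
    Antitone fun n => ∏ i ∈ range n, a i :=
  antitone_nat_of_succ_le fun n => by
    rw [prod_range_succ]
    exact mul_le_of_le_one_right' (ha n)

lemma tendsto_infProd {a : ℕ → ℝ≥0∞} (ha : ∀ i, a i ≤ 1) :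
    Tendsto (fun n => ∏ i ∈ range n, a i) atTop (𝓝 (infProd a)) :=
  tendsto_atTop_iInf (antitone_prod_range ha)

lemma infProd_le_one (a : ℕ → ℝ≥0∞) : infProd a ≤ 1 :=
  (iInf_le _ 0).trans (by simp)

lemma infProd_mono {a b : ℕ → ℝ≥0∞} (h : ∀ i, a i ≤ b i) : infProd a ≤ infProd b :=
  iInf_mono fun _ => prod_le_prod' fun i _ => h i

lemma measurable_infProd {E : Type*} [MeasurableSpace E] {a : ℕ → E → ℝ≥0∞}
    (ha : ∀ i, Measurable (a i)) : Measurable fun w => infProd fun i => a i w :=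
  Measurable.iInf fun _ => Finset.measurable_fun_prod _ fun i _ => ha i

/-- Replace the factors one at a time, bounding the remaining ones by 1. The subtraction is
truncated, so only indices with `b i < a i` contribute, which makes the bound one-sided. -/
lemma prod_le_prod_add_sum_sub {a b : ℕ → ℝ≥0∞} (ha : ∀ i, a i ≤ 1) (hb : ∀ i, b i ≤ 1)
    (s : Finset ℕ) : ∏ i ∈ s, a i ≤ ∏ i ∈ s, b i + ∑ i ∈ s, (a i - b i) := by
  induction s using Finset.induction_on with
  | empty => simp
  | insert x s hx ih =>
    rw [prod_insert hx, prod_insert hx, sum_insert hx]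
    have h1 : ∏ i ∈ s, a i ≤ 1 := prod_le_one' fun i _ => ha i
    calc a x * ∏ i ∈ s, a i ≤ (b x + (a x - b x)) * ∏ i ∈ s, a i := by
          gcongr; exact le_add_tsub
      _ = b x * ∏ i ∈ s, a i + (a x - b x) * ∏ i ∈ s, a i := add_mul _ _ _
      _ ≤ b x * (∏ i ∈ s, b i + ∑ i ∈ s, (a i - b i)) + (a x - b x) * 1 := by gcongr
      _ = b x * ∏ i ∈ s, b i + b x * ∑ i ∈ s, (a i - b i) + (a x - b x) := by
          rw [mul_add, mul_one]
      _ ≤ b x * ∏ i ∈ s, b i + 1 * ∑ i ∈ s, (a i - b i) + (a x - b x) := by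
          gcongr; exact hb x
      _ = _ := by rw [one_mul]; ring

lemma infProd_le_infProd_add_tsum_sub {a b : ℕ → ℝ≥0∞} (ha : ∀ i, a i ≤ 1) (hb : ∀ i, b i ≤ 1) :
    infProd a ≤ infProd b + ∑' i, (a i - b i) := by
  refine le_of_tendsto_of_tendsto (tendsto_infProd ha)
    ((tendsto_infProd hb).add ENNReal.summable.hasSum.tendsto_sum_nat)
    (Eventually.of_forall fun n => prod_le_prod_add_sum_sub ha hb _)

/-- Convergence plays no role: `expNeg` is continuous on all of `[0, ∞]`, and a divergent
interference sum corresponds to a vanishing product. -/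
lemma expNeg_tsum (v : ℕ → ℝ≥0∞) : expNeg (∑' i, v i) = infProd fun i => expNeg (v i) := by
  refine tendsto_nhds_unique ?_ (tendsto_infProd fun i => expNeg_le_one _)
  simp_rw [← expNeg_sum]
  exact (continuous_expNeg.tendsto _).comp ENNReal.summable.hasSum.tendsto_sum_nat

lemma infProd_mul {a b : ℕ → ℝ≥0∞} (ha : ∀ i, a i ≤ 1) (hb : ∀ i, b i ≤ 1) :
    infProd (fun i => a i * b i) = infProd a * infProd b := by
  refine tendsto_nhds_unique (tendsto_infProd fun i => mul_le_one' (ha i) (hb i)) ?_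
  simp_rw [prod_mul_distrib]
  exact ENNReal.Tendsto.mul (tendsto_infProd ha)
    (Or.inr ((infProd_le_one b).trans_lt ENNReal.one_lt_top).ne) (tendsto_infProd hb)
    (Or.inr ((infProd_le_one a).trans_lt ENNReal.one_lt_top).ne)

lemma infProd_eq_prod {a : ℕ → ℝ≥0∞} (ha : ∀ i, a i ≤ 1) (s : Finset ℕ)
    (hs : ∀ i, i ∉ s → a i = 1) : infProd a = ∏ i ∈ s, a i := by
  refine tendsto_nhds_unique (tendsto_infProd ha) (tendsto_const_nhds.congr' ?_)
  obtain ⟨N, hN⟩ := s.exists_nat_subset_range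
  filter_upwards [eventually_ge_atTop N] with n hn
  exact prod_subset (hN.trans (range_mono hn)) fun i _ hi => hs i hi

lemma infProd_one : infProd (fun _ => 1) = 1 := by
  simp [infProd]

lemma infProd_prod {ι : Type*} (s : Finset ι) {a : ι → ℕ → ℝ≥0∞} (ha : ∀ l i, a l i ≤ 1) :
    infProd (fun i => ∏ l ∈ s, a l i) = ∏ l ∈ s, infProd (a l) := by
  classical
  induction s using Finset.induction_on with
  | empty => simpa using infProd_one
  | insert x s hx ih =>
    simp_rw [prod_insert hx]
    rw [infProd_mul (ha x) fun i => prod_le_one' fun l _ => ha l i, ih]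

lemma infProd_ite {s : Set ℕ} [DecidablePred (· ∈ s)] (hs : s.Finite) {c : ℝ≥0∞} (hc : c ≤ 1) :
    infProd (fun i => if i ∈ s then c else 1) = c ^ s.ncard := by
  rw [infProd_eq_prod (fun i => by split_ifs <;> simp [hc]) hs.toFinset
    fun i hi => if_neg (by simpa using hi), Set.ncard_eq_toFinset_card _ hs, ← prod_const]
  exact prod_congr rfl fun i hi => if_pos (by simpa using hi)

/-- Separates the factor of the link itself from the factors of its interferers. -/
lemma infProd_update {a : ℕ → ℝ≥0∞} (ha : ∀ i, a i ≤ 1) (j : ℕ) {c : ℝ≥0∞} (hc : c ≤ 1) :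
    infProd (Function.update a j c) = c * infProd (Function.update a j 1) := by
  have h : Function.update a j c =
      fun i => Function.update (fun _ : ℕ => (1 : ℝ≥0∞)) j c i * Function.update a j 1 i := by
    ext i
    rcases eq_or_ne i j with rfl | hij <;> simp [*]
  have h1 (i : ℕ) : Function.update (fun _ : ℕ => (1 : ℝ≥0∞)) j c i ≤ 1 := by
    rcases eq_or_ne i j with rfl | hij <;> simp [*]
  rw [h, infProd_mul h1 fun i => ?_]
  · congr 1
    rw [infProd_eq_prod h1 {j} fun i hi => Function.update_of_ne (by simpa using hi) _ _]
    simp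
  · rcases eq_or_ne i j with rfl | hij <;> simp [*]

lemma update_le_one {a : ℕ → ℝ≥0∞} (ha : ∀ i, a i ≤ 1) (j i : ℕ) :
    Function.update a j 1 i ≤ 1 := by
  rcases eq_or_ne i j with rfl | hij <;> simp [*]

/-- Independence gives the finite products; the limit is monotone convergence for a decreasing
sequence bounded by 1. -/
lemma lintegral_infProd {E : Type*} [MeasurableSpace E] {Q : Measure E} [IsProbabilityMeasure Q]
    {Y : ℕ → E → ℝ≥0∞} (hY : ∀ i, Measurable (Y i)) (hY1 : ∀ i w, Y i w ≤ 1)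
    (hind : iIndepFun Y Q) :
    ∫⁻ w, infProd (fun i => Y i w) ∂Q = infProd fun i => ∫⁻ w, Y i w ∂Q := by
  unfold infProd
  rw [lintegral_iInf (fun n => Finset.measurable_fun_prod _ fun i _ => hY i)
    (fun m n h w => antitone_prod_range (fun i => hY1 i w) h) (by simp)]
  congr 1
  ext n
  have := lintegral_prod_eq_prod_lintegral_of_indepFun (range n) Y hind hY
  simpa using this

/-! ### Counts of a Poisson point process -/

section Counts

variable {Ω : Type*} {X : ℕ → Ω → ℂ}

lemma toENNReal_encard_eq_tsum (s : Set ℕ) :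
    ((s.encard : ℕ∞) : ℝ≥0∞) = ∑' i, s.indicator 1 i := by
  rw [← ENNReal.tsum_set_one, tsum_subtype s (fun _ => (1 : ℝ≥0∞))]
  rfl

lemma toENNReal_pointCount (A : Set ℂ) (w : Ω) :
    (pointCount X A w : ℝ≥0∞) = ∑' i, A.indicator 1 (X i w) :=
  toENNReal_encard_eq_tsum _

lemma pointCount_toNat (A : Set ℂ) (w : Ω) :
    (pointCount X A w).toNat = {i | X i w ∈ A}.ncard := rfl

lemma finite_of_pointCount_ne_top {A : Set ℂ} {w : Ω} (h : pointCount X A w ≠ ⊤) :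
    {i | X i w ∈ A}.Finite := Set.encard_ne_top_iff.1 h

lemma coe_toNat_pointCount {A : Set ℂ} {w : Ω} (h : pointCount X A w ≠ ⊤) :
    ((pointCount X A w).toNat : ℝ≥0∞) = ∑' i, A.indicator 1 (X i w) := by
  rw [← toENNReal_pointCount]
  conv_rhs => rw [← ENat.natCast_toNat h]
  simp

variable [MeasurableSpace Ω] {P : Measure Ω} {lam : ℝ}

lemma IsHomogeneousPPP.measurable_pointCount (hX : IsHomogeneousPPP P X lam) {A : Set ℂ}
    (hA : MeasurableSet A) : Measurable (pointCount X A) :=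
  measurable_encard.comp (measurable_set_iff.2 fun i => measurableSet_setOfPred.1 (hX.measurable i hA))

/-- The weights of the Poisson distribution. -/
noncomputable def poissonWeight (m : ℝ) (k : ℕ) : ℝ≥0∞ :=
  ENNReal.ofReal (Real.exp (-m) * m ^ k / (k.factorial : ℝ))

/-- The probability generating function of the Poisson law, by the exponential series. -/
lemma tsum_pow_mul_poissonWeight {m b : ℝ} (hm : 0 ≤ m) (hb : 0 ≤ b) :
    ∑' k, ENNReal.ofReal b ^ k * poissonWeight m k = ENNReal.ofReal (Real.exp (-(m * (1 - b)))) := by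
  have h := (NormedSpace.expSeries_div_hasSum_exp (b * m)).mul_left (Real.exp (-m))
  rw [← Real.exp_eq_exp_ℝ, ← Real.exp_add] at h
  have h2 (k : ℕ) : ENNReal.ofReal b ^ k * poissonWeight m k =
      ENNReal.ofReal (Real.exp (-m) * ((b * m) ^ k / (k.factorial : ℝ))) := by
    rw [poissonWeight, ← ENNReal.ofReal_pow hb, ← ENNReal.ofReal_mul (by positivity), mul_pow]
    congr 1
    ring
  simp_rw [h2]
  rw [← ENNReal.ofReal_tsum_of_nonneg (fun k => by positivity) h.summable, h.tsum_eq]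
  congr 2
  ring

lemma tsum_poissonWeight {m : ℝ} (hm : 0 ≤ m) : ∑' k, poissonWeight m k = 1 := by
  simpa using tsum_pow_mul_poissonWeight hm zero_le_one

/-- The recursion that characterizes Poisson weights, and the source of the Mecke formula. -/
lemma succ_mul_poissonWeight {m : ℝ} (hm : 0 ≤ m) (k : ℕ) :
    ((k + 1 : ℕ) : ℝ≥0∞) * poissonWeight m (k + 1) = ENNReal.ofReal m * poissonWeight m k := by
  rw [poissonWeight, poissonWeight, ← ENNReal.ofReal_natCast, ← ENNReal.ofReal_mul (by positivity),
    ← ENNReal.ofReal_mul hm]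
  congr 1
  rw [Nat.factorial_succ]
  push_cast
  field_simp
  ring

/-- The Poisson weights of the finite values already sum to 1, so no mass is left for `⊤`. -/
lemma IsHomogeneousPPP.ae_pointCount_ne_top [IsProbabilityMeasure P] (hlam : 0 < lam)
    (hX : IsHomogeneousPPP P X lam) {A : Set ℂ} (hA : MeasurableSet A) (hA' : volume A < ∞) :
    ∀ᵐ w ∂P, pointCount X A w ≠ ⊤ := by
  have hm := hX.measurable_pointCount hA
  have h1 : P (⋃ k : ℕ, {w | pointCount X A w = (k : ℕ∞)}) = 1 := by
    rw [measure_iUnion]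
    · simp_rw [hX.poisson A hA hA']
      exact tsum_poissonWeight (by positivity)
    · intro k l hkl
      refine Set.disjoint_left.2 fun w hk hl => hkl ?_
      simp only [Set.mem_ofPred_eq] at hk hl
      exact_mod_cast hk.symm.trans hl
    · exact fun k => hm (measurableSet_singleton _)
  have h2 := (prob_compl_eq_zero_iff
    (MeasurableSet.iUnion fun k : ℕ => hm (measurableSet_singleton (k : ℕ∞)))).2 h1
  rw [ae_iff]
  refine measure_mono_null (fun w hw => ?_) h2
  simp only [ne_eq, not_not, Set.mem_ofPred_eq] at hw
  simp [hw]

lemma IsHomogeneousPPP.lintegral_pointCount [IsProbabilityMeasure P] (hlam : 0 < lam)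
    (hX : IsHomogeneousPPP P X lam) {A : Set ℂ} (hA : MeasurableSet A) (hA' : volume A < ∞)
    (F : ℕ → ℝ≥0∞) :
    ∫⁻ w, F (pointCount X A w).toNat ∂P =
      ∑' k, F k * poissonWeight (lam * (volume A).toReal) k := by
  have hm := hX.measurable_pointCount hA
  have h1 : ∀ᵐ w ∂P, F (pointCount X A w).toNat =
      ∑' k : ℕ, {w | pointCount X A w = (k : ℕ∞)}.indicator (fun _ => F k) w := by
    filter_upwards [hX.ae_pointCount_ne_top hlam hA hA'] with w hw
    rw [tsum_eq_single (pointCount X A w).toNat]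
    · rw [Set.indicator_of_mem]
      exact (ENat.natCast_toNat hw).symm
    · intro k hk
      refine Set.indicator_of_notMem (fun h => hk ?_) _
      simp only [Set.mem_ofPred_eq] at h
      simp [h]
  have hk (k : ℕ) : MeasurableSet {w | pointCount X A w = (k : ℕ∞)} :=
    hm (measurableSet_singleton _)
  rw [lintegral_congr_ae h1, lintegral_tsum fun k =>
    (measurable_const.indicator (hk k)).aemeasurable]
  congr 1
  ext k
  rw [lintegral_indicator_const (hk k)]
  exact congrArg _ (hX.poisson A hA hA' k)

lemma IsHomogeneousPPP.lintegral_pow_pointCount [IsProbabilityMeasure P] (hlam : 0 < lam)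
    (hX : IsHomogeneousPPP P X lam) {A : Set ℂ} (hA : MeasurableSet A) (hA' : volume A < ∞)
    {a : ℝ≥0∞} (ha : a ≤ 1) :
    ∫⁻ w, a ^ (pointCount X A w).toNat ∂P =
      expNeg (ENNReal.ofReal lam * (volume A * (1 - a))) := by
  rw [hX.lintegral_pointCount hlam hA hA' fun k => a ^ k]
  have ha' : a ≠ ∞ := (ha.trans_lt ENNReal.one_lt_top).ne
  obtain ⟨b, hb, rfl⟩ : ∃ b : ℝ, 0 ≤ b ∧ a = ENNReal.ofReal b :=
    ⟨a.toReal, ENNReal.toReal_nonneg, (ENNReal.ofReal_toReal ha').symm⟩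
  have hb1 : b ≤ 1 := by simpa using ha
  rw [tsum_pow_mul_poissonWeight (by positivity) hb]
  conv_rhs => rw [← ENNReal.ofReal_toReal hA'.ne, ← ENNReal.ofReal_one,
    ← ENNReal.ofReal_sub _ hb, ← ENNReal.ofReal_mul (by positivity),
    ← ENNReal.ofReal_mul hlam.le]
  rw [expNeg_ofReal (mul_nonneg hlam.le (mul_nonneg (by positivity) (by linarith)))]
  congr 3
  ring

/-- The Mecke formula for a single set: removing one point from a size-biased Poisson count gives
the same Poisson law again. -/
lemma IsHomogeneousPPP.lintegral_pointCount_mul [IsProbabilityMeasure P] (hlam : 0 < lam)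
    (hX : IsHomogeneousPPP P X lam) {A : Set ℂ} (hA : MeasurableSet A) (hA' : volume A < ∞)
    (F : ℕ → ℝ≥0∞) :
    ∫⁻ w, (pointCount X A w).toNat * F ((pointCount X A w).toNat - 1) ∂P =
      ENNReal.ofReal lam * volume A * ∫⁻ w, F (pointCount X A w).toNat ∂P := by
  rw [hX.lintegral_pointCount hlam hA hA' F,
    hX.lintegral_pointCount hlam hA hA' fun k => k * F (k - 1),
    -- The term `k = 0` vanishes, so the truncated `k - 1` never matters.
    tsum_eq_zero_add' ENNReal.summable, ← ENNReal.tsum_mul_left]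
  simp only [Nat.cast_zero, zero_mul, zero_add, Nat.add_sub_cancel]
  congr 1
  ext k
  rw [mul_right_comm, succ_mul_poissonWeight (by positivity), ENNReal.ofReal_mul hlam.le,
    ENNReal.ofReal_toReal hA'.ne]
  ring

lemma IsHomogeneousPPP.lintegral_toNat_pointCount [IsProbabilityMeasure P] (hlam : 0 < lam)
    (hX : IsHomogeneousPPP P X lam) {A : Set ℂ} (hA : MeasurableSet A) (hA' : volume A < ∞) :
    ∫⁻ w, ((pointCount X A w).toNat : ℝ≥0∞) ∂P = ENNReal.ofReal lam * volume A := by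
  simpa using hX.lintegral_pointCount_mul hlam hA hA' fun _ => 1

lemma IsHomogeneousPPP.iIndepFun_pointCount (hX : IsHomogeneousPPP P X lam) {ι : Type*} [Fintype ι]
    {A : ι → Set ℂ} (hA : ∀ l, MeasurableSet (A l)) (hA' : ∀ l, volume (A l) < ∞)
    (hd : Pairwise fun k l => Disjoint (A k) (A l)) :
    iIndepFun (fun l => pointCount X (A l)) P := by
  let e := Fintype.equivFin ι
  have h := hX.indep _ (fun k => A (e.symm k)) (fun k => hA _) (fun k => hA' _)
    fun k l hkl => hd (e.symm.injective.ne hkl)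
  simpa using h.precomp e.injective

open Classical in
/-- The Mecke formula for functionals of finitely many counts. -/
lemma IsHomogeneousPPP.lintegral_tsum_step [IsProbabilityMeasure P] (hlam : 0 < lam)
    (hX : IsHomogeneousPPP P X lam) {ι : Type*} [Fintype ι]
    {A : ι → Set ℂ} (hA : ∀ l, MeasurableSet (A l)) (hA' : ∀ l, volume (A l) < ∞)
    (hd : Pairwise fun k l => Disjoint (A k) (A l)) {a : ι → ℝ≥0∞} (ha : ∀ l, a l ≤ 1) (d : ι) :
    ∫⁻ w, ∑' j, (A d).indicator 1 (X j w) * infProd (Function.update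
        (fun i => ∏ l, if X i w ∈ A l then a l else 1) j 1) ∂P =
      ENNReal.ofReal lam * volume (A d) *
        expNeg (ENNReal.ofReal lam * ∑ l, volume (A l) * (1 - a l)) := by
  -- The omitted point `j` lies in the cell `A d`: this cell loses one factor and is weighted by its
  -- count, the other cells keep all their factors.
  set F : ι → ℕ∞ → ℝ≥0∞ := fun l n =>
    if l = d then n.toNat * a l ^ (n.toNat - 1) else a l ^ n.toNat with hF
  have h1 : ∀ᵐ w ∂P, ∑' j, (A d).indicator 1 (X j w) * infProd (Function.update
      (fun i => ∏ l, if X i w ∈ A l then a l else 1) j 1) =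
      ∏ l, F l (pointCount X (A l) w) := by
    filter_upwards [ae_all_iff.2 fun l => hX.ae_pointCount_ne_top hlam (hA l) (hA' l)] with w hw
    have key (j : ℕ) (hj : X j w ∈ A d) : infProd (Function.update
        (fun i => ∏ l, if X i w ∈ A l then a l else 1) j 1) =
        ∏ l, if l = d then a l ^ ((pointCount X (A l) w).toNat - 1)
          else a l ^ (pointCount X (A l) w).toNat := by
      have e1 : Function.update (fun i => ∏ l, if X i w ∈ A l then a l else 1) j 1 =
          fun i => ∏ l, if i ∈ {i | X i w ∈ A l} \ {j} then a l else 1 := by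
        ext i
        rcases eq_or_ne i j with rfl | hij <;> simp [*]
      rw [e1, infProd_prod _ fun l i => by split_ifs <;> simp [ha l]]
      refine prod_congr rfl fun l _ => ?_
      have hfin := finite_of_pointCount_ne_top (hw l)
      rw [infProd_ite (hfin.subset Set.sdiff_subset) (ha l), pointCount_toNat]
      split_ifs with hl
      · subst hl
        rw [Set.ncard_sdiff_singleton_of_mem (a := j) (s := {i | X i w ∈ A l}) hj]
      · rw [Set.sdiff_singleton_eq_self]
        exact fun h => Set.disjoint_left.1 (hd hl) h hj
    have e2 (j : ℕ) : (A d).indicator 1 (X j w) * infProd (Function.update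
        (fun i => ∏ l, if X i w ∈ A l then a l else 1) j 1) = (A d).indicator 1 (X j w) *
        ∏ l, if l = d then a l ^ ((pointCount X (A l) w).toNat - 1)
          else a l ^ (pointCount X (A l) w).toNat := by
      by_cases hj : X j w ∈ A d
      · rw [key j hj]
      · simp [hj]
    simp_rw [e2]
    -- After the rewriting the product no longer depends on `j`, so the sum over `j` only counts the
    -- points in `A d`.
    rw [ENNReal.tsum_mul_right, ← coe_toNat_pointCount (hw d),
      ← mul_prod_erase univ _ (mem_univ d), ← mul_prod_erase univ _ (mem_univ d), ← mul_assoc]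
    simp only [hF, if_true]
    congr 1
    exact prod_congr rfl fun l hl => by simp [ne_of_mem_erase hl]
  rw [lintegral_congr_ae h1]
  have hind : iIndepFun (fun l w => F l (pointCount X (A l) w)) P :=
    (hX.iIndepFun_pointCount hA hA' hd).comp F fun _ => measurable_of_countable _
  rw [lintegral_prod_eq_prod_lintegral_of_indepFun univ _ hind fun l =>
    (measurable_of_countable (F l)).comp (hX.measurable_pointCount (hA l))]
  have e3 (l : ι) : ∫⁻ w, F l (pointCount X (A l) w) ∂P =
      (if l = d then ENNReal.ofReal lam * volume (A d) else 1) *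
        expNeg (ENNReal.ofReal lam * (volume (A l) * (1 - a l))) := by
    simp only [hF]
    split_ifs with hl
    · subst hl
      rw [hX.lintegral_pointCount_mul hlam (hA l) (hA' l) fun k => a l ^ k,
        hX.lintegral_pow_pointCount hlam (hA l) (hA' l) (ha l)]
    · rw [hX.lintegral_pow_pointCount hlam (hA l) (hA' l) (ha l), one_mul]
  simp_rw [e3]
  rw [prod_mul_distrib, mul_sum, expNeg_sum]
  simp

end Counts

/-! ### The second factorial moment measure -/

section SecondMoment

variable {Ω : Type*} {X : ℕ → Ω → ℂ} [MeasurableSpace Ω] {P : Measure Ω} {lam : ℝ}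

/-- The second factorial moment measure of a point process. -/
noncomputable def secondMoment (P : Measure Ω) (X : ℕ → Ω → ℂ) : Measure (ℂ × ℂ) :=
  Measure.sum fun p : ℕ × ℕ => if p.2 = p.1 then 0 else P.map fun w => (X p.1 w, X p.2 w)

lemma lintegral_secondMoment (hX : ∀ i, Measurable (X i)) {φ : ℂ × ℂ → ℝ≥0∞} (hφ : Measurable φ) :
    ∫⁻ z, φ z ∂(secondMoment P X) =
      ∫⁻ w, ∑' j, ∑' i, if i = j then 0 else φ (X j w, X i w) ∂P := by
  have hm (j i : ℕ) : Measurable fun w => if i = j then 0 else φ (X j w, X i w) := by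
    split_ifs
    · exact measurable_const
    · exact hφ.comp ((hX j).prodMk (hX i))
  rw [secondMoment, lintegral_sum_measure,
    lintegral_tsum fun j => (Measurable.tsum fun i => hm j i).aemeasurable,
    ENNReal.tsum_prod']
  congr 1
  ext j
  rw [lintegral_tsum fun i => (hm j i).aemeasurable]
  congr 1
  ext i
  split_ifs with h
  · simp
  · rw [lintegral_map hφ ((hX j).prodMk (hX i))]

lemma secondMoment_prod (hX : ∀ i, Measurable (X i)) {A B : Set ℂ} (hA : MeasurableSet A)
    (hB : MeasurableSet B) : secondMoment P X (A ×ˢ B) =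
      ∫⁻ w, ∑' j, ∑' i, if i = j then 0 else A.indicator 1 (X j w) * B.indicator 1 (X i w) ∂P := by
  rw [← lintegral_indicator_one (hA.prod hB),
    lintegral_secondMoment hX (measurable_one.indicator (hA.prod hB))]
  refine lintegral_congr fun w => tsum_congr fun j => tsum_congr fun i => ?_
  by_cases h1 : X j w ∈ A <;> by_cases h2 : X i w ∈ B <;> simp [h1, h2]

lemma IsHomogeneousPPP.secondMoment_disjoint [IsProbabilityMeasure P] (hlam : 0 < lam)
    (hX : IsHomogeneousPPP P X lam) {A B : Set ℂ} (hA : MeasurableSet A) (hA' : volume A < ∞)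
    (hB : MeasurableSet B) (hB' : volume B < ∞) (hAB : Disjoint A B) :
    secondMoment P X (A ×ˢ B) = (ENNReal.ofReal lam * volume A) * (ENNReal.ofReal lam * volume B) := by
  rw [secondMoment_prod hX.measurable hA hB]
  have h1 : ∀ᵐ w ∂P, (∑' j, ∑' i, if i = j then 0 else
      A.indicator (1 : ℂ → ℝ≥0∞) (X j w) * B.indicator 1 (X i w)) =
      (pointCount X A w).toNat * (pointCount X B w).toNat := by
    filter_upwards [hX.ae_pointCount_ne_top hlam hA hA', hX.ae_pointCount_ne_top hlam hB hB']
      with w hw1 hw2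
    rw [coe_toNat_pointCount hw1, coe_toNat_pointCount hw2, ← ENNReal.tsum_mul_right]
    refine tsum_congr fun j => ?_
    rw [← ENNReal.tsum_mul_left]
    refine tsum_congr fun i => ?_
    split_ifs with h
    · subst h
      by_cases h1 : X i w ∈ A
      · simp [Set.disjoint_left.1 hAB h1]
      · simp [h1]
    · rfl
  rw [lintegral_congr_ae h1]
  have hind : IndepFun (pointCount X A) (pointCount X B) P := by
    have := hX.iIndepFun_pointCount (A := fun b : Bool => if b then A else B)
      (by simp [hA, hB]) (by simp [hA', hB']) (by
        rintro (_ | _) (_ | _) h <;> simp_all [hAB.symm])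
    simpa using this.indepFun (i := true) (j := false) (by simp)
  have hcast : Measurable fun n : ℕ∞ => (n.toNat : ℝ≥0∞) := measurable_of_countable _
  have := lintegral_mul_eq_lintegral_mul_lintegral_of_indepFun
    (hcast.comp (hX.measurable_pointCount hA)) (hcast.comp (hX.measurable_pointCount hB))
    (hind.comp hcast hcast)
  rw [← hX.lintegral_toNat_pointCount hlam hA hA', ← hX.lintegral_toNat_pointCount hlam hB hB']
  exact this

/-- The ordered pairs of distinct points in `A` number `N (N - 1)`, whose mean is the second
factorial moment of a Poisson variable. -/
lemma IsHomogeneousPPP.secondMoment_self [IsProbabilityMeasure P] (hlam : 0 < lam)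
    (hX : IsHomogeneousPPP P X lam) {A : Set ℂ} (hA : MeasurableSet A) (hA' : volume A < ∞) :
    secondMoment P X (A ×ˢ A) = (ENNReal.ofReal lam * volume A) * (ENNReal.ofReal lam * volume A) := by
  rw [secondMoment_prod hX.measurable hA hA]
  have h1 : ∀ᵐ w ∂P, (∑' j, ∑' i, if i = j then 0 else
      A.indicator (1 : ℂ → ℝ≥0∞) (X j w) * A.indicator 1 (X i w)) =
      (pointCount X A w).toNat * ((pointCount X A w).toNat - 1 : ℕ) := by
    filter_upwards [hX.ae_pointCount_ne_top hlam hA hA'] with w hw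
    have hfin := finite_of_pointCount_ne_top hw
    have e (j : ℕ) : (∑' i, if i = j then 0 else
        A.indicator (1 : ℂ → ℝ≥0∞) (X j w) * A.indicator 1 (X i w)) =
        A.indicator 1 (X j w) * ((pointCount X A w).toNat - 1 : ℕ) := by
      by_cases hj : X j w ∈ A
      · have : ((({i | X i w ∈ A} \ {j} : Set ℕ).encard : ℕ∞) : ℝ≥0∞) =
            ((pointCount X A w).toNat - 1 : ℕ) := by
          rw [pointCount_toNat,
            ← Set.ncard_sdiff_singleton_of_mem (a := j) (s := {i | X i w ∈ A}) hj,
            ← (hfin.subset Set.sdiff_subset).cast_ncard_eq]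
          simp
        rw [← this, toENNReal_encard_eq_tsum, ← ENNReal.tsum_mul_left]
        refine tsum_congr fun i => ?_
        by_cases hij : i = j <;> by_cases hi : X i w ∈ A <;> simp [hij, hi, hj]
      · simp [hj]
    simp_rw [e]
    rw [ENNReal.tsum_mul_right, ← coe_toNat_pointCount hw]
  rw [lintegral_congr_ae h1, hX.lintegral_pointCount_mul hlam hA hA' fun k => (k : ℝ≥0∞),
    hX.lintegral_toNat_pointCount hlam hA hA']

/-- Cutting along `A ∩ B` leaves only rectangles whose sides are equal or disjoint. -/
lemma IsHomogeneousPPP.secondMoment_rect [IsProbabilityMeasure P] (hlam : 0 < lam)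
    (hX : IsHomogeneousPPP P X lam) {A B : Set ℂ} (hA : MeasurableSet A) (hA' : volume A < ∞)
    (hB : MeasurableSet B) (hB' : volume B < ∞) :
    secondMoment P X (A ×ˢ B) = (ENNReal.ofReal lam * volume A) * (ENNReal.ofReal lam * volume B) := by
  have hI := hA.inter hB
  have hI' := (measure_mono (μ := volume) (Set.inter_subset_left (s := A) (t := B))).trans_lt hA'
  have hAd := hA.diff hB
  have hAd' := (measure_mono (μ := volume) (Set.sdiff_subset (s := A) (t := B))).trans_lt hA'
  have hBd := hB.diff hA
  have hBd' := (measure_mono (μ := volume) (Set.sdiff_subset (s := B) (t := A))).trans_lt hB'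
  have d1 : Disjoint (A ∩ B) (A \ B) := Set.disjoint_left.2 fun x h1 h2 => h2.2 h1.2
  have d2 : Disjoint (A ∩ B) (B \ A) := Set.disjoint_left.2 fun x h1 h2 => h2.2 h1.1
  have d3 : Disjoint (A \ B) (B \ A) := Set.disjoint_left.2 fun x h1 h2 => h2.2 h1.1
  have eA : A = (A ∩ B) ∪ (A \ B) := (Set.inter_union_sdiff A B).symm
  have eB : B = (A ∩ B) ∪ (B \ A) := by rw [Set.inter_comm]; exact (Set.inter_union_sdiff B A).symm
  have vA : volume A = volume (A ∩ B) + volume (A \ B) := by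
    conv_lhs => rw [eA]
    exact measure_union d1 hAd
  have vB : volume B = volume (A ∩ B) + volume (B \ A) := by
    conv_lhs => rw [eB]
    exact measure_union d2 hBd
  have split_left (C : Set ℂ) (hC : MeasurableSet C) : secondMoment P X (A ×ˢ C) =
      secondMoment P X ((A ∩ B) ×ˢ C) + secondMoment P X ((A \ B) ×ˢ C) := by
    conv_lhs => rw [eA, Set.union_prod]
    exact measure_union (Set.disjoint_prod.2 (Or.inl d1)) (hAd.prod hC)
  have split_right (C : Set ℂ) (hC : MeasurableSet C) : secondMoment P X (C ×ˢ B) =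
      secondMoment P X (C ×ˢ (A ∩ B)) + secondMoment P X (C ×ˢ (B \ A)) := by
    conv_lhs => rw [eB, Set.prod_union]
    exact measure_union (Set.disjoint_prod.2 (Or.inr d2)) (hC.prod hBd)
  rw [split_left B hB, split_right _ hI, split_right _ hAd, hX.secondMoment_self hlam hI hI',
    hX.secondMoment_disjoint hlam hI hI' hBd hBd' d2,
    hX.secondMoment_disjoint hlam hAd hAd' hI hI' d1.symm,
    hX.secondMoment_disjoint hlam hAd hAd' hBd hBd' d3, vA, vB]
  ring

/-- Both measures agree on rectangles with sides of finite area; such sides form a generating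
π-system that spans the plane. -/
lemma IsHomogeneousPPP.secondMoment_eq [IsProbabilityMeasure P] (hlam : 0 < lam)
    (hX : IsHomogeneousPPP P X lam) :
    secondMoment P X = (ENNReal.ofReal lam * ENNReal.ofReal lam) • (volume.prod volume) := by
  have key : ((ENNReal.ofReal lam • volume : Measure ℂ)).prod (ENNReal.ofReal lam • volume) =
      secondMoment P X := by
    let C : Set (Set ℂ) := {s | MeasurableSet s ∧ volume s < ∞}
    have hC : MeasurableSpace.generateFrom C = borel ℂ := by
      refine le_antisymm (MeasurableSpace.generateFrom_le fun s hs => ?_) fun s hs => ?_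
      · rw [← BorelSpace.measurable_eq (α := ℂ)]; exact hs.1
      · rw [← BorelSpace.measurable_eq (α := ℂ)] at hs
        rw [← Set.inter_univ s, ← iUnion_spanningSets (volume : Measure ℂ), Set.inter_iUnion]
        refine MeasurableSet.iUnion fun n => MeasurableSpace.measurableSet_generateFrom
          ⟨hs.inter (measurableSet_spanningSets _ n), ?_⟩
        exact (measure_mono Set.inter_subset_right).trans_lt (measure_spanningSets_lt_top _ n)
    rw [← BorelSpace.measurable_eq (α := ℂ)] at hC
    have hpi : IsPiSystem C := fun s hs t ht _ =>
      ⟨hs.1.inter ht.1, (measure_mono Set.inter_subset_left).trans_lt hs.2⟩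
    have hspan : (ENNReal.ofReal lam • volume : Measure ℂ).FiniteSpanningSetsIn C :=
      { set := spanningSets volume
        set_mem := fun n => ⟨measurableSet_spanningSets _ n, measure_spanningSets_lt_top _ n⟩
        finite := fun n => by
          simpa using ENNReal.mul_lt_top ENNReal.ofReal_lt_top
            (measure_spanningSets_lt_top (volume : Measure ℂ) n)
        spanning := iUnion_spanningSets _ }
    exact Measure.prod_eq_generateFrom hC hC hpi hpi hspan hspan fun s hs t ht => by
      simpa using hX.secondMoment_rect hlam hs.1 hs.2 ht.1 ht.2
  rw [← key, Measure.prod_smul_left, Measure.prod_smul_right, smul_smul]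

lemma IsHomogeneousPPP.lintegral_tsum_tsum [IsProbabilityMeasure P] (hlam : 0 < lam)
    (hX : IsHomogeneousPPP P X lam) {φ : ℂ × ℂ → ℝ≥0∞} (hφ : Measurable φ) :
    ∫⁻ w, ∑' j, ∑' i, (if i = j then 0 else φ (X j w, X i w)) ∂P =
      ENNReal.ofReal lam * ENNReal.ofReal lam * ∫⁻ x, ∫⁻ u, φ (x, u) := by
  rw [← lintegral_secondMoment hX.measurable hφ, hX.secondMoment_eq hlam, lintegral_smul_measure,
    lintegral_prod _ hφ.aemeasurable, smul_eq_mul]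

end SecondMoment

/-! ### The reduced Palm expectation of a product functional -/

section PalmProduct

variable {Ω : Type*} {X : ℕ → Ω → ℂ} [MeasurableSpace Ω] {P : Measure Ω} {lam : ℝ}

/-- The sum over the points `x` of the process in the window `C` of the product of `k x u` over the
other points `u`, in the mean. -/
noncomputable def palmProduct (P : Measure Ω) (X : ℕ → Ω → ℂ) (C : Set ℂ)
    (k : ℂ → ℂ → ℝ≥0∞) : ℝ≥0∞ :=
  ∫⁻ w, ∑' j, C.indicator 1 (X j w) *
    infProd (Function.update (fun i => k (X j w) (X i w)) j 1) ∂P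

lemma measurable_infProd_update {E : Type*} [MeasurableSpace E] {a : ℕ → E → ℝ≥0∞}
    (ha : ∀ i, Measurable (a i)) (j : ℕ) :
    Measurable fun w => infProd (Function.update (fun i => a i w) j 1) := by
  refine measurable_infProd (a := fun i w => Function.update (fun i => a i w) j 1 i) fun i => ?_
  rcases eq_or_ne i j with rfl | hij
  · simp
  · simpa [hij] using ha i

lemma measurable_palm_summand (hX : ∀ i, Measurable (X i)) {C : Set ℂ} (hC : MeasurableSet C)
    {k : ℂ → ℂ → ℝ≥0∞} (hk : Measurable (Function.uncurry k)) (j : ℕ) :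
    Measurable fun w => C.indicator (1 : ℂ → ℝ≥0∞) (X j w) *
      infProd (Function.update (fun i => k (X j w) (X i w)) j 1) :=
  ((measurable_one.indicator hC).comp (hX j)).mul
    (measurable_infProd_update (fun i => hk.comp ((hX j).prodMk (hX i))) j)

lemma palmProduct_mono {C : Set ℂ} {k k' : ℂ → ℂ → ℝ≥0∞} (h : ∀ x u, k x u ≤ k' x u) :
    palmProduct P X C k ≤ palmProduct P X C k' := by
  refine lintegral_mono fun w => ENNReal.tsum_le_tsum fun j => ?_
  gcongr
  refine infProd_mono fun i => ?_
  rcases eq_or_ne i j with rfl | hij <;> simp [*]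

lemma palmProduct_congr {C : Set ℂ} {k k' : ℂ → ℂ → ℝ≥0∞} (h : ∀ x ∈ C, ∀ u, k x u = k' x u) :
    palmProduct P X C k = palmProduct P X C k' := by
  refine lintegral_congr fun w => tsum_congr fun j => ?_
  by_cases hj : X j w ∈ C
  · simp_rw [h _ hj]
  · simp [hj]

lemma palmProduct_biUnion (hX : ∀ i, Measurable (X i)) {ι : Type*} (s : Finset ι) {C : ι → Set ℂ}
    (hC : ∀ v, MeasurableSet (C v)) (hd : (s : Set ι).PairwiseDisjoint C)
    {k : ℂ → ℂ → ℝ≥0∞} (hk : Measurable (Function.uncurry k)) :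
    palmProduct P X (⋃ v ∈ s, C v) k = ∑ v ∈ s, palmProduct P X (C v) k := by
  unfold palmProduct
  rw [← lintegral_finsetSum s fun v _ => Measurable.tsum fun j =>
    measurable_palm_summand hX (hC v) hk j]
  refine lintegral_congr fun w => ?_
  rw [← Summable.tsum_finsetSum fun v _ => ENNReal.summable]
  refine tsum_congr fun j => ?_
  rw [← sum_mul, Finset.indicator_biUnion_apply s C hd]

/-- Two products of numbers in `[0, 1]` differ by at most the sum of the differences of their
factors, and that sum runs over pairs of distinct points, so its mean is an integral against the
second moment measure. Every approximation of the factors from now on is controlled by this bound.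
-/
lemma IsHomogeneousPPP.palmProduct_le [IsProbabilityMeasure P] (hlam : 0 < lam)
    (hX : IsHomogeneousPPP P X lam) {C : Set ℂ} (hC : MeasurableSet C)
    {k k' : ℂ → ℂ → ℝ≥0∞} (hk : Measurable (Function.uncurry k))
    (hk' : Measurable (Function.uncurry k')) (h1 : ∀ x u, k x u ≤ 1) (h1' : ∀ x u, k' x u ≤ 1) :
    palmProduct P X C k ≤ palmProduct P X C k' +
      ENNReal.ofReal lam * ENNReal.ofReal lam * ∫⁻ x in C, ∫⁻ u, (k x u - k' x u) := by
  have hφ : Measurable fun z : ℂ × ℂ =>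
      C.indicator (1 : ℂ → ℝ≥0∞) z.1 * (k z.1 z.2 - k' z.1 z.2) :=
    ((measurable_one.indicator hC).comp measurable_fst).mul (hk.sub hk')
  have e : ∫⁻ x in C, ∫⁻ u, (k x u - k' x u) =
      ∫⁻ x, ∫⁻ u, C.indicator (1 : ℂ → ℝ≥0∞) x * (k x u - k' x u) := by
    rw [← lintegral_indicator hC]
    refine lintegral_congr fun x => ?_
    by_cases hx : x ∈ C <;> simp [hx]
  rw [e, ← hX.lintegral_tsum_tsum hlam hφ, palmProduct, palmProduct,
    ← lintegral_add_left (Measurable.tsum fun j => measurable_palm_summand hX.measurable hC hk' j)]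
  refine lintegral_mono fun w => ?_
  rw [← ENNReal.tsum_add]
  refine ENNReal.tsum_le_tsum fun j => ?_
  have h := infProd_le_infProd_add_tsum_sub (update_le_one (fun i => h1 (X j w) (X i w)) j)
    (update_le_one (fun i => h1' (X j w) (X i w)) j)
  calc _ ≤ _ := mul_le_mul_right h _
    _ = _ := by
      rw [mul_add, ← ENNReal.tsum_mul_left]
      congr 1
      refine tsum_congr fun i => ?_
      rcases eq_or_ne i j with rfl | hij <;> simp [*]

open Classical in
-- The level sets of `f`, cut along `C`, are the cells of the step formula `lintegral_tsum_step`;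
-- summing over the cells inside `C` recovers `C`. Since `f` may exceed 1, the exponent contains `1
-- - (1 - f u)`, that is, `min (f u) 1`.
lemma IsHomogeneousPPP.palmProduct_simpleFunc [IsProbabilityMeasure P] (hlam : 0 < lam)
    (hX : IsHomogeneousPPP P X lam) {C : Set ℂ} (hC : MeasurableSet C) (hC' : volume C < ∞)
    (f : SimpleFunc ℂ ℝ≥0∞) (hf : ∫⁻ u, f u ≠ ∞) :
    palmProduct P X C (fun _ u => 1 - f u) =
      ENNReal.ofReal lam * volume C * expNeg (ENNReal.ofReal lam * ∫⁻ u, (1 - (1 - f u))) := by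
  let ι := f.range × Bool
  -- The zero level outside `C` may have infinite area; its factor is 1, so it is left out.
  let A : ι → Set ℂ := fun p => if p.2 then C ∩ f ⁻¹' {p.1.1} else
    if p.1.1 = 0 then ∅ else f ⁻¹' {p.1.1} \ C
  let a : ι → ℝ≥0∞ := fun p => 1 - p.1.1
  have hmem (p : ι) (u : ℂ) (hu : u ∈ A p) : f u = p.1.1 ∧ (u ∈ C ↔ p.2 = true) := by
    simp only [A] at hu
    split_ifs at hu with h1 h2
    · exact ⟨hu.2, by simp [hu.1, h1]⟩
    · exact hu.elim
    · exact ⟨hu.1, by simp [hu.2, h1]⟩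
  have hA (p : ι) : MeasurableSet (A p) := by
    simp only [A]
    split_ifs
    · exact hC.inter (f.measurableSet_fiber _)
    · exact MeasurableSet.empty
    · exact (f.measurableSet_fiber _).diff hC
  have hA' (p : ι) : volume (A p) < ∞ := by
    simp only [A]
    split_ifs with h1 h2
    · exact (measure_mono Set.inter_subset_left).trans_lt hC'
    · simp
    -- Markov's inequality: an integrable function takes a nonzero value only on a set of finite
    -- area.
    · refine (measure_mono Set.sdiff_subset).trans_lt ?_
      refine ENNReal.lt_top_of_mul_ne_top_right (ne_top_of_le_ne_top hf ?_) h2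
      refine le_trans ?_ (mul_meas_ge_le_lintegral f.measurable p.1.1)
      gcongr
      exact fun u hu => (show f u = p.1.1 from hu).ge
  have hd : Pairwise fun p q => Disjoint (A p) (A q) := by
    intro p q hpq
    refine Set.disjoint_left.2 fun u hp hq => hpq ?_
    obtain ⟨h1, h2⟩ := hmem p u hp
    obtain ⟨h3, h4⟩ := hmem q u hq
    refine Prod.ext (Subtype.ext (h1.symm.trans h3)) ?_
    rw [Bool.eq_iff_iff, ← h2, ← h4]
  have ha (p : ι) : a p ≤ 1 := tsub_le_self
  have hout (u : ℂ) : (∀ p, u ∉ A p) → f u = 0 := by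
    intro h
    by_contra h0
    have hr : f u ∈ f.range := f.mem_range_self u
    by_cases hu : u ∈ C
    · exact h (⟨f u, hr⟩, true) (by simp [A, hu])
    · exact h (⟨f u, hr⟩, false) (by simp [A, hu, h0])
  have hprod (u : ℂ) : ∏ p, (if u ∈ A p then a p else 1) = 1 - f u := by
    by_cases h : ∃ p, u ∈ A p
    · obtain ⟨p, hp⟩ := h
      rw [Fintype.prod_eq_single p fun q hq => if_neg fun hq' =>
        Set.disjoint_left.1 (hd hq) hq' hp, if_pos hp, (hmem p u hp).1]
    · push Not at h
      rw [hout u h]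
      simp [h]
  have hsum : ∫⁻ u, (1 - (1 - f u)) = ∑ p, volume (A p) * (1 - a p) := by
    have e (u : ℂ) : 1 - (1 - f u) = ∑ p, (A p).indicator (fun _ => 1 - a p) u := by
      by_cases h : ∃ p, u ∈ A p
      · obtain ⟨p, hp⟩ := h
        rw [Fintype.sum_eq_single p fun q hq => Set.indicator_of_notMem (fun hq' =>
          Set.disjoint_left.1 (hd hq) hq' hp) _, Set.indicator_of_mem hp, (hmem p u hp).1]
      · push Not at h
        rw [hout u h]
        simp [h]
    simp_rw [e]
    rw [lintegral_finsetSum _ fun p _ => measurable_const.indicator (hA p)]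
    refine sum_congr rfl fun p _ => ?_
    rw [lintegral_indicator_const (hA p), mul_comm]
  have hCU : C = ⋃ v ∈ (univ : Finset f.range), A (v, true) := by
    ext u
    simp [A]
  have hk : Measurable (Function.uncurry fun _ u : ℂ => 1 - f u) :=
    measurable_const.sub (f.measurable.comp measurable_snd)
  have hd' : ((univ : Finset f.range) : Set f.range).PairwiseDisjoint fun v => A (v, true) :=
    fun v _ v' _ hv => hd (by simpa [ι] using hv)
  have hvol : volume C = ∑ v : f.range, volume (A (v, true)) := by
    conv_lhs => rw [hCU]
    exact measure_biUnion_finset hd' fun v _ => hA _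
  have hpiece (v : f.range) : palmProduct P X (A (v, true)) (fun _ u => 1 - f u) =
      ENNReal.ofReal lam * volume (A (v, true)) *
        expNeg (ENNReal.ofReal lam * ∫⁻ u, (1 - (1 - f u))) := by
    rw [hsum, ← hX.lintegral_tsum_step hlam hA hA' hd ha (v, true)]
    simp_rw [hprod]
    rfl
  conv_lhs => rw [hCU]
  rw [palmProduct_biUnion hX.measurable univ (fun v => hA _) hd' hk]
  simp_rw [hpiece]
  rw [← sum_mul, ← mul_sum, ← hvol]

/-- Simple functions increase to `f`. Monotonicity of the product gives one inequality; the other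
follows from `palmProduct_le`, whose error is `volume C` times the `L¹` distance, up to `lam²`. -/
lemma IsHomogeneousPPP.palmProduct_const [IsProbabilityMeasure P] (hlam : 0 < lam)
    (hX : IsHomogeneousPPP P X lam) {C : Set ℂ} (hC : MeasurableSet C) (hC' : volume C < ∞)
    {f : ℂ → ℝ≥0∞} (hf : Measurable f) (hf1 : ∀ u, f u ≤ 1) (hfi : ∫⁻ u, f u ≠ ∞) :
    palmProduct P X C (fun _ u => 1 - f u) =
      ENNReal.ofReal lam * volume C * expNeg (ENNReal.ofReal lam * ∫⁻ u, f u) := by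
  let g : ℕ → SimpleFunc ℂ ℝ≥0∞ := SimpleFunc.eapprox f
  have hgm : Monotone g := SimpleFunc.monotone_eapprox f
  have hsup (u : ℂ) : ⨆ n, g n u = f u := SimpleFunc.iSup_eapprox_apply hf u
  have hgf (n : ℕ) (u : ℂ) : g n u ≤ f u := (le_iSup (fun n => g n u) n).trans_eq (hsup u)
  have hg1 (n : ℕ) (u : ℂ) : 1 - (1 - g n u) = g n u :=
    ENNReal.sub_sub_cancel ENNReal.one_ne_top ((hgf n u).trans (hf1 u))
  have hgi (n : ℕ) : ∫⁻ u, g n u ≠ ∞ := ((lintegral_mono (hgf n)).trans_lt hfi.lt_top).ne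
  have hlim : Tendsto (fun n => ∫⁻ u, g n u) atTop (𝓝 (∫⁻ u, f u)) := by
    simp_rw [← hsup]
    rw [lintegral_iSup (fun n => (g n).measurable) hgm]
    exact tendsto_atTop_iSup fun m n h => lintegral_mono (hgm h)
  have hexp : Tendsto (fun n => palmProduct P X C (fun _ u => 1 - g n u)) atTop
      (𝓝 (ENNReal.ofReal lam * volume C * expNeg (ENNReal.ofReal lam * ∫⁻ u, f u))) := by
    simp_rw [fun n => hX.palmProduct_simpleFunc hlam hC hC' (g n) (hgi n), hg1]
    refine ENNReal.Tendsto.const_mul ((continuous_expNeg.tendsto _).comp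
      (ENNReal.Tendsto.const_mul hlim (Or.inr ENNReal.ofReal_ne_top)))
      (Or.inr (ENNReal.mul_lt_top ENNReal.ofReal_lt_top hC').ne)
  have hmf : Measurable (Function.uncurry fun _ u : ℂ => 1 - f u) :=
    measurable_const.sub (hf.comp measurable_snd)
  have hmg (n : ℕ) : Measurable (Function.uncurry fun _ u : ℂ => 1 - g n u) :=
    measurable_const.sub ((g n).measurable.comp measurable_snd)
  refine le_antisymm (ge_of_tendsto' hexp fun n => palmProduct_mono fun _ u =>
    tsub_le_tsub_left (hgf n u) 1) ?_
  have herr : Tendsto (fun n => palmProduct P X C (fun _ u => 1 - f u) +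
      ENNReal.ofReal lam * ENNReal.ofReal lam * ∫⁻ _ in C, ∫⁻ u, ((1 - g n u) - (1 - f u)))
      atTop (𝓝 (palmProduct P X C (fun _ u => 1 - f u) +
        ENNReal.ofReal lam * ENNReal.ofReal lam * 0)) := by
    refine tendsto_const_nhds.add (ENNReal.Tendsto.const_mul ?_
      (Or.inr (ENNReal.mul_lt_top ENNReal.ofReal_lt_top ENNReal.ofReal_lt_top).ne))
    simp_rw [setLIntegral_const]
    have e (n : ℕ) : ∫⁻ u, ((1 - g n u) - (1 - f u)) = (∫⁻ u, f u) - ∫⁻ u, g n u := by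
      rw [← lintegral_sub (g n).measurable (hgi n) (ae_of_all _ (hgf n))]
      refine lintegral_congr fun u => ?_
      have h3 : g n u ≠ ∞ := ((hgf n u).trans_lt ((hf1 u).trans_lt ENNReal.one_lt_top)).ne
      have h4 : (1 : ℝ≥0∞) = f u - g n u + (1 - f u) + g n u := by
        rw [add_right_comm, tsub_add_cancel_of_le (hgf n u), add_tsub_cancel_of_le (hf1 u)]
      have h5 : 1 - g n u = f u - g n u + (1 - f u) :=
        ENNReal.sub_eq_of_eq_add h3 h4
      rw [h5, ENNReal.add_sub_cancel_right
        (tsub_le_self.trans_lt ENNReal.one_lt_top).ne]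
    simp_rw [e]
    have h0 : Tendsto (fun n => (∫⁻ u, f u) - ∫⁻ u, g n u) atTop (𝓝 0) := by
      have := ENNReal.Tendsto.sub (tendsto_const_nhds (x := ∫⁻ u, f u)) hlim (Or.inl hfi)
      simpa using this
    simpa using ENNReal.Tendsto.mul_const h0 (Or.inr hC'.ne)
  simp only [mul_zero, add_zero] at herr
  exact le_of_tendsto_of_tendsto' hexp herr fun n =>
    hX.palmProduct_le hlam hC (hmg n) hmf (fun _ _ => tsub_le_self) fun _ _ => tsub_le_self

end PalmProduct

/-! ### The Mecke formula for products depending on relative positions -/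

section Translate

/-- Translation is continuous in `L¹`. -/
lemma tendsto_lintegral_enorm_translate_sub {g : ℂ → ℝ} (hg : MemLp g 1 volume) {y : ℕ → ℂ} {x : ℂ}
    (hy : Tendsto y atTop (𝓝 x)) :
    Tendsto (fun n => ∫⁻ u, ‖g (u - y n) - g (u - x)‖ₑ) atTop (𝓝 0) := by
  let c : ℂ × ℂ → ℂ := fun p => p.2 - p.1
  have hc : Continuous c := continuous_snd.sub continuous_fst
  -- Currying makes `z ↦ (u ↦ u - z)` continuous for the compact-open topology, which gives
  -- continuity of composition in `L¹` for measure-preserving maps.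
  let T : C(ℂ, C(ℂ, ℂ)) := (ContinuousMap.mk c hc).curry
  have hT (z : ℂ) : MeasurePreserving (T z) volume volume :=
    measurePreserving_sub_right volume z
  have h := Filter.Tendsto.compMeasurePreservingLp (l := atTop)
    (tendsto_const_nhds (x := hg.toLp g)) ((T.continuous.tendsto x).comp hy)
    (fun n => hT (y n)) (hT x) ENNReal.one_ne_top
  rw [tendsto_iff_edist_tendsto_0] at h
  refine h.congr fun n => ?_
  simp only [Lp.toLp_compMeasurePreserving]
  rw [Lp.edist_toLp_toLp, eLpNorm_one_eq_lintegral_enorm]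
  rfl

variable {Ω : Type*} {X : ℕ → Ω → ℂ} [MeasurableSpace Ω] {P : Measure Ω} {lam : ℝ}

/-- On each fibre of `φ` the shift is constant, and shifting `f` by a constant does not change its
integral. -/
lemma IsHomogeneousPPP.palmProduct_translate_simpleFunc [IsProbabilityMeasure P] (hlam : 0 < lam)
    (hX : IsHomogeneousPPP P X lam) {C : Set ℂ} (hC : MeasurableSet C) (hC' : volume C < ∞)
    {f : ℂ → ℝ≥0∞} (hf : Measurable f) (hf1 : ∀ u, f u ≤ 1) (hfi : ∫⁻ u, f u ≠ ∞)
    (φ : SimpleFunc ℂ ℂ) :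
    palmProduct P X C (fun x u => 1 - f (u - φ x)) =
      ENNReal.ofReal lam * volume C * expNeg (ENNReal.ofReal lam * ∫⁻ u, f u) := by
  have hCU : C = ⋃ v ∈ φ.range, (C ∩ φ ⁻¹' {v}) := by
    ext x
    simp
  have hm (v : ℂ) : MeasurableSet (C ∩ φ ⁻¹' {v}) := hC.inter (φ.measurableSet_fiber v)
  have hd : (φ.range : Set ℂ).PairwiseDisjoint fun v => C ∩ φ ⁻¹' {v} := by
    intro v _ v' _ hv
    exact Set.disjoint_left.2 fun x h h' => hv (h.2.symm.trans h'.2)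
  have hk : Measurable (Function.uncurry fun x u => 1 - f (u - φ x)) :=
    measurable_const.sub (hf.comp (measurable_snd.sub (φ.measurable.comp measurable_fst)))
  have hpiece (v : ℂ) : palmProduct P X (C ∩ φ ⁻¹' {v}) (fun x u => 1 - f (u - φ x)) =
      ENNReal.ofReal lam * volume (C ∩ φ ⁻¹' {v}) *
        expNeg (ENNReal.ofReal lam * ∫⁻ u, f u) := by
    have h := hX.palmProduct_const hlam (hm v)
      ((measure_mono Set.inter_subset_left).trans_lt hC')
      (hf.comp (measurable_id.sub_const v)) (fun u => hf1 _)
      (by simpa using (lintegral_sub_right_eq_self f v).trans_ne hfi)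
    have h2 := lintegral_sub_right_eq_self (μ := volume) f v
    simp only [Function.comp_def, id] at h
    rw [h2] at h
    rw [← h]
    exact palmProduct_congr fun x hx u => by rw [show φ x = v from hx.2]
  conv_lhs => rw [hCU]
  rw [palmProduct_biUnion hX.measurable _ hm hd hk]
  simp_rw [hpiece]
  rw [← sum_mul, ← mul_sum, ← measure_biUnion_finset hd fun v _ => hm v, ← hCU]

/-- The reference point `x` is approximated by simple functions `φ n x`. The error in either
direction is at most `lam²` times the integral over `C` of the `L¹` distance between two translates
of `f`. It vanishes by continuity of translation, with dominating constant `2 ∫ f` on the set `C` of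
finite area. -/
lemma IsHomogeneousPPP.palmProduct_translate_of_ne_top [IsProbabilityMeasure P] (hlam : 0 < lam)
    (hX : IsHomogeneousPPP P X lam) {C : Set ℂ} (hC : MeasurableSet C) (hC' : volume C < ∞)
    {f : ℂ → ℝ≥0∞} (hf : Measurable f) (hf1 : ∀ u, f u ≤ 1) (hfi : ∫⁻ u, f u ≠ ∞) :
    palmProduct P X C (fun x u => 1 - f (u - x)) =
      ENNReal.ofReal lam * volume C * expNeg (ENNReal.ofReal lam * ∫⁻ u, f u) := by
  set R := ENNReal.ofReal lam * volume C * expNeg (ENNReal.ofReal lam * ∫⁻ u, f u)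
  set c := ENNReal.ofReal lam * ENNReal.ofReal lam
  have hc : c ≠ ∞ := (ENNReal.mul_lt_top ENNReal.ofReal_lt_top ENNReal.ofReal_lt_top).ne
  have hfin (u : ℂ) : f u ≠ ∞ := ((hf1 u).trans_lt ENNReal.one_lt_top).ne
  let g : ℂ → ℝ := fun u => (f u).toReal
  have hgm : Measurable g := hf.ennreal_toReal
  have hge (u : ℂ) : ‖g u‖ₑ = f u := by
    rw [Real.enorm_of_nonneg ENNReal.toReal_nonneg, ENNReal.ofReal_toReal (hfin u)]
  have hg : MemLp g 1 volume := by
    refine ⟨hgm.aestronglyMeasurable, ?_⟩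
    rw [eLpNorm_one_eq_lintegral_enorm]
    simp_rw [hge]
    exact hfi.lt_top
  let φ : ℕ → SimpleFunc ℂ ℂ :=
    SimpleFunc.approxOn id measurable_id Set.univ 0 (Set.mem_univ 0)
  have hφ (x : ℂ) : Tendsto (fun n => φ n x) atTop (𝓝 x) :=
    SimpleFunc.tendsto_approxOn measurable_id (Set.mem_univ 0) (by simp)
  let D : ℕ → ℂ → ℝ≥0∞ := fun n x => ∫⁻ u, ‖g (u - φ n x) - g (u - x)‖ₑ
  have hm (n : ℕ) : Measurable fun z : ℂ × ℂ => g (z.2 - φ n z.1) :=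
    hgm.comp (measurable_snd.sub ((φ n).measurable.comp measurable_fst))
  have hm' : Measurable fun z : ℂ × ℂ => g (z.2 - z.1) :=
    hgm.comp (measurable_snd.sub measurable_fst)
  have hD : Tendsto (fun n => ∫⁻ x in C, D n x) atTop (𝓝 0) := by
    have h := tendsto_lintegral_of_dominated_convergence (μ := volume.restrict C) (F := D)
      (f := fun _ => 0) (fun _ => (∫⁻ u, f u) + ∫⁻ u, f u)
      (fun n => Measurable.lintegral_prod_right' ((hm n).sub hm').enorm) (fun n => ?_) ?_ ?_
    · simpa using h
    · refine ae_of_all _ fun x => ?_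
      calc D n x ≤ ∫⁻ u, (f (u - φ n x) + f (u - x)) := by
            refine lintegral_mono fun u => ?_
            rw [← hge, ← hge]
            exact enorm_sub_le
        _ = _ := by
            rw [lintegral_add_left (by fun_prop), lintegral_sub_right_eq_self,
              lintegral_sub_right_eq_self]
    · rw [setLIntegral_const]
      exact (ENNReal.mul_lt_top (ENNReal.add_lt_top.2 ⟨hfi.lt_top, hfi.lt_top⟩) hC').ne
    · exact ae_of_all _ fun x => tendsto_lintegral_enorm_translate_sub hg (hφ x)
  have hcD : Tendsto (fun n => c * ∫⁻ x in C, D n x) atTop (𝓝 0) := by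
    simpa using ENNReal.Tendsto.const_mul hD (Or.inr hc)
  have hsub {a b : ℂ} : (1 - f a) - (1 - f b) ≤ ‖g b - g a‖ₑ := by
    rw [tsub_le_iff_right, tsub_le_iff_right, add_right_comm, add_assoc]
    have h1 : f b ≤ f a + ‖g b - g a‖ₑ := by
      rw [← hge, ← hge]
      calc ‖g b‖ₑ = ‖g a + (g b - g a)‖ₑ := by rw [add_sub_cancel]
        _ ≤ _ := enorm_add_le _ _
    calc (1 : ℝ≥0∞) = f b + (1 - f b) := (add_tsub_cancel_of_le (hf1 b)).symm
      _ ≤ f a + ‖g b - g a‖ₑ + (1 - f b) := by gcongr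
      _ = _ := by ring
  have hk (n : ℕ) : Measurable (Function.uncurry fun x u => 1 - f (u - φ n x)) :=
    measurable_const.sub (hf.comp (measurable_snd.sub ((φ n).measurable.comp measurable_fst)))
  have hk' : Measurable (Function.uncurry fun x u : ℂ => 1 - f (u - x)) :=
    measurable_const.sub (hf.comp (measurable_snd.sub measurable_fst))
  have hR (n : ℕ) := hX.palmProduct_translate_simpleFunc hlam hC hC' hf hf1 hfi (φ n)
  refine le_antisymm ?_ ?_
  · refine ge_of_tendsto' (f := fun n => R + c * ∫⁻ x in C, D n x) (x := atTop)
      (by simpa using tendsto_const_nhds.add hcD) fun n => ?_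
    refine (hX.palmProduct_le hlam hC hk' (hk n) (fun _ _ => tsub_le_self)
      fun _ _ => tsub_le_self).trans ?_
    rw [hR n]
    gcongr with x
    exact lintegral_mono fun u => hsub
  · refine ge_of_tendsto' (f := fun n => palmProduct P X C (fun x u => 1 - f (u - x)) +
      c * ∫⁻ x in C, D n x) (x := atTop) (by simpa using tendsto_const_nhds.add hcD) fun n => ?_
    have h := hX.palmProduct_le hlam hC (hk n) hk' (fun _ _ => tsub_le_self)
      fun _ _ => tsub_le_self
    rw [hR n] at h
    refine h.trans ?_
    gcongr with x
    refine lintegral_mono fun u => ?_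
    rw [enorm_sub_rev]
    exact hsub

/-- The Mecke formula for products of a function of the relative positions of the points. -/
theorem IsHomogeneousPPP.palmProduct_translate [IsProbabilityMeasure P] (hlam : 0 < lam)
    (hX : IsHomogeneousPPP P X lam) {C : Set ℂ} (hC : MeasurableSet C) (hC' : volume C < ∞)
    {h : ℂ → ℝ≥0∞} (hh : Measurable h) (hh1 : ∀ u, h u ≤ 1) :
    palmProduct P X C (fun x u => h (u - x)) =
      ENNReal.ofReal lam * volume C * expNeg (ENNReal.ofReal lam * ∫⁻ u, (1 - h u)) := by
  have e (u : ℂ) : 1 - (1 - h u) = h u := ENNReal.sub_sub_cancel ENNReal.one_ne_top (hh1 u)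
  have hf : Measurable fun u => 1 - h u := measurable_const.sub hh
  by_cases hfi : ∫⁻ u, (1 - h u) = ∞
  -- The right-hand side is now zero, so only an upper bound is needed. Cutting `1 - h` off outside
  -- a ball increases the product and makes the integral finite; the bounds tend to zero as the
  -- balls grow.
  · rw [hfi, ENNReal.mul_top (by simpa using hlam), expNeg_top, mul_zero]
    let b : ℕ → Set ℂ := fun n => Metric.ball 0 n
    have hb (n : ℕ) : MeasurableSet (b n) := measurableSet_ball
    have hbm : Monotone b := fun m n hmn => Metric.ball_subset_ball (by exact_mod_cast hmn)
    let f : ℕ → ℂ → ℝ≥0∞ := fun n => (b n).indicator fun u => 1 - h u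
    have hf1 (n : ℕ) (u : ℂ) : f n u ≤ 1 :=
      (Set.indicator_le_self _ _ u).trans tsub_le_self
    have hffin (n : ℕ) : ∫⁻ u, f n u ≠ ∞ := by
      rw [lintegral_indicator (hb n)]
      refine ne_top_of_le_ne_top ?_ (lintegral_mono fun u => tsub_le_self (a := 1) (b := h u))
      rw [setLIntegral_const, one_mul]
      exact measure_ball_lt_top.ne
    have hlim : Tendsto (fun n => ∫⁻ u, f n u) atTop (𝓝 ∞) := by
      rw [← hfi]
      have e2 : ∫⁻ u, (1 - h u) = ⨆ n, ∫⁻ u, f n u := by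
        rw [← lintegral_iSup (fun n => hf.indicator (hb n)) fun m n hmn u =>
          Set.indicator_le_indicator_of_subset (hbm hmn) (fun _ => zero_le) u]
        refine lintegral_congr fun u => le_antisymm ?_
          (iSup_le fun n => Set.indicator_le_self _ _ u)
        obtain ⟨n, hn⟩ := exists_nat_gt ‖u‖
        refine le_iSup_of_le n ?_
        simp [b, hn]
      rw [e2]
      exact tendsto_atTop_iSup fun m n hmn => lintegral_mono fun u =>
        Set.indicator_le_indicator_of_subset (hbm hmn) (fun _ => zero_le) u
    have hlim2 : Tendsto (fun n => ENNReal.ofReal lam * volume C *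
        expNeg (ENNReal.ofReal lam * ∫⁻ u, f n u)) atTop (𝓝 0) := by
      have h3 := ENNReal.Tendsto.const_mul (a := ENNReal.ofReal lam * volume C)
        ((continuous_expNeg.tendsto _).comp (ENNReal.Tendsto.const_mul (a := ENNReal.ofReal lam)
          hlim (Or.inr ENNReal.ofReal_ne_top)))
        (Or.inr (ENNReal.mul_lt_top ENNReal.ofReal_lt_top hC').ne)
      rw [ENNReal.mul_top (by simpa using hlam), expNeg_top, mul_zero] at h3
      exact h3
    refine le_antisymm (ge_of_tendsto' hlim2 fun n => ?_) zero_le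
    rw [← hX.palmProduct_translate_of_ne_top hlam hC hC' (hf.indicator (hb n)) (hf1 n) (hffin n)]
    refine palmProduct_mono fun x u => ?_
    calc h (u - x) = 1 - (1 - h (u - x)) := (e _).symm
      _ ≤ _ := tsub_le_tsub_left (Set.indicator_le_self (b n) (fun u => 1 - h u) (u - x)) 1
  · have := hX.palmProduct_translate_of_ne_top hlam hC hC' hf (fun u => tsub_le_self) hfi
    simp_rw [e] at this
    exact this

end Translate

/-! ### Infinite product measures -/

section InfinitePi

/-- Resampling one coordinate of a product measure. -/
lemma lintegral_infinitePi_update {ι : Type*} [DecidableEq ι] {E : ι → Type*}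
    [∀ i, MeasurableSpace (E i)] (μ : ∀ i, Measure (E i)) [∀ i, IsProbabilityMeasure (μ i)] (a : ι)
    {f : (∀ i, E i) → ℝ≥0∞} (hf : Measurable f) :
    ∫⁻ m, f m ∂(Measure.infinitePi μ) =
      ∫⁻ m, ∫⁻ y, f (Function.update m a y) ∂(μ a) ∂(Measure.infinitePi μ) := by
  have hu : Measurable fun p : (∀ i, E i) × E a => Function.update p.1 a p.2 := by
    refine measurable_pi_lambda _ fun i => ?_
    rcases eq_or_ne i a with rfl | hi
    · simpa using measurable_snd
    · simp only [Function.update_of_ne hi]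
      fun_prop
  have h : ((Measure.infinitePi μ).prod (μ a)).map (fun p => Function.update p.1 a p.2) =
      Measure.infinitePi μ := by
    refine Measure.eq_infinitePi μ fun s t ht => ?_
    rw [Measure.map_apply hu (MeasurableSet.pi s.countable_toSet fun i _ => ht i)]
    by_cases ha : a ∈ s
    · have e : (fun p : (∀ i, E i) × E a => Function.update p.1 a p.2) ⁻¹' (Set.pi s t) =
          (Set.pi (s.erase a) t) ×ˢ (t a) := by
        ext p
        simp only [Set.mem_preimage, Set.mem_pi, Set.mem_prod, mem_coe, mem_erase]
        constructor
        · refine fun h => ⟨fun i hi => by simpa [hi.1] using h i hi.2, by simpa using h a ha⟩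
        · intro h i hi
          rcases eq_or_ne i a with rfl | hia
          · simpa using h.2
          · simpa [hia] using h.1 i ⟨hia, hi⟩
      rw [e, Measure.prod_prod, Measure.infinitePi_pi _ fun i _ => ht i, mul_comm,
        mul_prod_erase s (fun i => μ i (t i)) ha]
    · have e : (fun p : (∀ i, E i) × E a => Function.update p.1 a p.2) ⁻¹' (Set.pi s t) =
          (Set.pi s t) ×ˢ Set.univ := by
        ext p
        simp only [Set.mem_preimage, Set.mem_pi, Set.mem_prod, mem_coe, Set.mem_univ, and_true]
        refine forall₂_congr fun i hi => ?_
        rw [Function.update_of_ne (ne_of_mem_of_not_mem hi ha)]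
      rw [e, Measure.prod_prod, Measure.infinitePi_pi _ fun i _ => ht i, measure_univ, mul_one]
  conv_lhs => rw [← h]
  have hfu : Measurable fun p : (∀ i, E i) × E a => f (Function.update p.1 a p.2) := hf.comp hu
  rw [lintegral_map hf hu, lintegral_prod _ hfu.aemeasurable]

lemma lintegral_infinitePi_fin_three (μ : Fin 3 → Measure ℝ) [∀ i, IsProbabilityMeasure (μ i)]
    {φ : ℝ → ℝ → ℝ → ℝ≥0∞} (hφ : Measurable fun p : ℝ × ℝ × ℝ => φ p.1 p.2.1 p.2.2) :
    ∫⁻ z, φ (z 0) (z 1) (z 2) ∂(Measure.infinitePi μ) =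
      ∫⁻ a, ∫⁻ b, ∫⁻ c, φ a b c ∂(μ 2) ∂(μ 1) ∂(μ 0) := by
  have h2 : Measurable fun p : ℝ × ℝ => ∫⁻ c, φ p.1 p.2 c ∂(μ 2) := by
    refine Measurable.lintegral_prod_right' (f := fun q : (ℝ × ℝ) × ℝ => φ q.1.1 q.1.2 q.2) ?_
    exact hφ.comp (measurable_fst.fst.prodMk (measurable_fst.snd.prodMk measurable_snd))
  have h1 : Measurable fun a : ℝ => ∫⁻ b, ∫⁻ c, φ a b c ∂(μ 2) ∂(μ 1) :=
    Measurable.lintegral_prod_right' h2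
  have m2 : Measurable fun z : Fin 3 → ℝ => φ (z 0) (z 1) (z 2) :=
    hφ.comp (f := fun z : Fin 3 → ℝ => (z 0, z 1, z 2)) (by fun_prop)
  have m1 : Measurable fun z : Fin 3 → ℝ => ∫⁻ c, φ (z 0) (z 1) c ∂(μ 2) :=
    h2.comp (f := fun z : Fin 3 → ℝ => (z 0, z 1)) (by fun_prop)
  have m0 : Measurable fun z : Fin 3 → ℝ => ∫⁻ b, ∫⁻ c, φ (z 0) b c ∂(μ 2) ∂(μ 1) :=
    h1.comp (measurable_pi_apply 0)
  rw [lintegral_infinitePi_update μ 2 m2]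
  simp only [Function.update_self, ne_eq, Fin.reduceEq, not_false_eq_true, Function.update_of_ne]
  rw [lintegral_infinitePi_update μ 1 m1]
  simp only [Function.update_self, ne_eq, Fin.reduceEq, not_false_eq_true, Function.update_of_ne]
  rw [lintegral_infinitePi_update μ 0 m0]
  simp

/-- The mean of a product of functions of disjoint blocks of coordinates. -/
lemma lintegral_infProd_blocks {ι : Type*} {κ : ℕ → Type*} (μ : ι → Measure ℝ)
    [∀ i, IsProbabilityMeasure (μ i)] (e : ∀ i, κ i → ι)
    (he : Function.Injective fun p : (Σ i, κ i) => e p.1 p.2) {ψ : ∀ i, (κ i → ℝ) → ℝ≥0∞}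
    (hψ : ∀ i, Measurable (ψ i)) (hψ1 : ∀ i z, ψ i z ≤ 1) :
    ∫⁻ m, infProd (fun i => ψ i fun k => m (e i k)) ∂(Measure.infinitePi μ) =
      infProd fun i => ∫⁻ z, ψ i z ∂(Measure.infinitePi fun k => μ (e i k)) := by
  -- Reading off the distinct coordinates `e i k` yields a product measure over pairs `(i, k)`;
  -- currying turns it into a product over `i` of block laws, in which the blocks are independent.
  have h1 := Measure.map_infinitePi_infinitePi_of_inj (P := μ) he
  have h2 := Measure.infinitePi_map_piCurry (X := fun i (_ : κ i) => ℝ) fun i k => μ (e i k)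
  have hm : Measurable fun (m : ι → ℝ) (p : Σ i, κ i) => m (e p.1 p.2) :=
    measurable_pi_lambda _ fun p => measurable_pi_apply _
  have hmeas : Measurable fun z : (∀ i, κ i → ℝ) => infProd fun i => ψ i (z i) :=
    measurable_infProd fun i => (hψ i).comp (measurable_pi_apply i)
  have h3 : ∫⁻ m, infProd (fun i => ψ i fun k => m (e i k)) ∂(Measure.infinitePi μ) =
      ∫⁻ z, infProd (fun i => ψ i (z i))
        ∂(Measure.infinitePi fun i => Measure.infinitePi fun k => μ (e i k)) := by
    rw [← h2, lintegral_map hmeas (MeasurableEquiv.measurable _), ← h1]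
    exact (lintegral_map (hmeas.comp
      (MeasurableEquiv.piCurry fun i (_ : κ i) => ℝ).measurable) hm).symm
  have h4 := lintegral_infProd (Y := fun i (z : ∀ i, κ i → ℝ) => ψ i (z i))
    (fun i => (hψ i).comp (measurable_pi_apply i)) (fun i z => hψ1 i _)
    (iIndepFun_infinitePi (P := fun i => Measure.infinitePi fun k => μ (e i k)) hψ)
  rw [h3, h4]
  congr 1
  ext i
  exact (measurePreserving_eval_infinitePi
    (fun i => Measure.infinitePi fun k => μ (e i k)) i).lintegral_comp (hψ i)

end InfinitePi

/-! ### Exponential fading and uniform orientations -/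

section Fading

instance : IsProbabilityMeasure (expMeasure 1) := isProbabilityMeasure_expMeasure one_pos

instance : IsProbabilityMeasure uniformAngle := by
  refine cond_isProbabilityMeasure_of_finite ?_ ?_ <;> simp [Real.pi_pos, ENNReal.mul_eq_top]

instance (m : Mark) : IsProbabilityMeasure (markLaw m) := by
  cases m <;> simp only [markLaw] <;> infer_instance

lemma expMeasure_Iic {t : ℝ} (ht : 0 ≤ t) :
    expMeasure 1 (Set.Iic t) = 1 - expNeg (ENNReal.ofReal t) := by
  have h := cdf_expMeasure_eq one_pos t
  rw [if_pos ht, cdf_eq_real, one_mul] at h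
  rw [expNeg_ofReal ht, ← ENNReal.ofReal_one, ← ENNReal.ofReal_sub _ (Real.exp_pos _).le, ← h,
    ofReal_measureReal]

lemma expMeasure_Ioi {t : ℝ} (ht : 0 ≤ t) :
    expMeasure 1 (Set.Ioi t) = expNeg (ENNReal.ofReal t) := by
  rw [← Set.compl_Iic, prob_compl_eq_one_sub measurableSet_Iic, expMeasure_Iic ht,
    ENNReal.sub_sub_cancel ENNReal.one_ne_top (expNeg_le_one _)]

lemma expMeasure_Iio {t : ℝ} (ht : 0 ≤ t) :
    expMeasure 1 (Set.Iio t) = 1 - expNeg (ENNReal.ofReal t) := by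
  have hac : expMeasure 1 ≪ volume := withDensity_absolutelyContinuous _ _
  rw [← expMeasure_Iic ht]
  exact measure_congr (hac.ae_eq Iio_ae_eq_Iic)

/-- The Laplace transform of the exponential distribution. -/
lemma lintegral_expNeg_expMeasure {s : ℝ} (hs : 0 ≤ s) :
    ∫⁻ y, expNeg (ENNReal.ofReal (y * s)) ∂(expMeasure 1) = (1 + ENNReal.ofReal s)⁻¹ := by
  have hd : expMeasure 1 = volume.withDensity (exponentialPDF 1) := rfl
  have hm (r : ℝ) : Measurable (exponentialPDF r) :=
    (measurable_exponentialPDFReal r).ennreal_ofReal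
  have hE : Measurable fun y : ℝ => expNeg (ENNReal.ofReal (y * s)) :=
    measurable_expNeg.comp (by fun_prop)
  rw [hd, lintegral_withDensity_eq_lintegral_mul _ (hm 1) hE]
  have hs' : (0 : ℝ) < 1 + s := by linarith
  have e (y : ℝ) : (exponentialPDF 1 * fun y => expNeg (ENNReal.ofReal (y * s))) y =
      ENNReal.ofReal (1 + s)⁻¹ * exponentialPDF (1 + s) y := by
    rw [Pi.mul_apply]
    rcases lt_or_ge y 0 with hy | hy
    · simp [exponentialPDF_of_neg hy]
    · rw [exponentialPDF_of_nonneg hy, exponentialPDF_of_nonneg hy, expNeg_ofReal (by positivity),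
        ← ENNReal.ofReal_mul (by positivity), ← ENNReal.ofReal_mul (by positivity), one_mul,
        ← Real.exp_add, ← mul_assoc, inv_mul_cancel₀ hs'.ne', one_mul, one_mul]
      congr 2
      ring
  simp_rw [e]
  rw [lintegral_const_mul _ (hm _), lintegral_exponentialPDF_eq_one hs', mul_one,
    ENNReal.ofReal_inv_of_pos hs', ENNReal.ofReal_add zero_le_one hs, ENNReal.ofReal_one]

/-- The probability that the signal-to-interference ratio exceeds a threshold, for exponential
fading of the signal. -/
lemma expMeasure_lt_div {t A : ℝ} (ht : 0 < t) (hA : 0 < A) (D : ℝ≥0∞) :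
    expMeasure 1 {y | ENNReal.ofReal t < ENNReal.ofReal (y * A) / D} =
      expNeg (ENNReal.ofReal (t / A) * D) := by
  have htA : 0 < t / A := div_pos ht hA
  rcases eq_or_ne D ∞ with rfl | hD
  · simp [ENNReal.mul_top, htA]
  obtain ⟨d, hd, rfl⟩ : ∃ d : ℝ, 0 ≤ d ∧ D = ENNReal.ofReal d :=
    ⟨D.toReal, ENNReal.toReal_nonneg, (ENNReal.ofReal_toReal hD).symm⟩
  rw [← ENNReal.ofReal_mul htA.le, ← expMeasure_Ioi (by positivity)]
  congr 1
  ext y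
  rw [Set.mem_ofPred_eq, Set.mem_Ioi]
  -- For zero denominator the quotient is `∞` if `y > 0` and `0 / 0 = 0` otherwise, so the event is
  -- still `0 < y`.
  rcases hd.eq_or_lt with rfl | hd
  · rcases le_or_gt y 0 with hy | hy
    · have : ENNReal.ofReal (y * A) = 0 :=
        ENNReal.ofReal_of_nonpos (mul_nonpos_of_nonpos_of_nonneg hy hA.le)
      simp [this, hy]
    · have : 0 < y * A := mul_pos hy hA
      rw [ENNReal.ofReal_zero, ENNReal.div_zero (by simpa using this)]
      simp [hy]
  · rw [← ENNReal.ofReal_div_of_pos hd, ENNReal.ofReal_lt_ofReal_iff_of_nonneg ht.le,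
      lt_div_iff₀ hd, div_mul_eq_mul_div, div_lt_iff₀ hA]

lemma expMeasure_mul_lt {K r : ℝ} (hK : 0 ≤ K) (hr : 0 < r) :
    expMeasure 1 {y | y * K < r} = 1 - expNeg (ENNReal.ofReal r / ENNReal.ofReal K) := by
  -- With zero gain the event is certain, matching `r / 0 = ∞` and `expNeg ∞ = 0`.
  rcases hK.eq_or_lt with rfl | hK
  · simp [hr, ENNReal.div_zero]
  · rw [← ENNReal.ofReal_div_of_pos hK, ← expMeasure_Iio (by positivity)]
    congr 1
    ext y
    rw [Set.mem_ofPred_eq, Set.mem_Iio, lt_div_iff₀ hK]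

/-- Both intervals are fundamental domains for translation by multiples of `T`. -/
lemma setLIntegral_Ioc_of_periodic {T : ℝ} (hT : 0 < T) {f : ℝ → ℝ≥0∞}
    (hf : Function.Periodic f T) (a b : ℝ) :
    ∫⁻ x in Set.Ioc a (a + T), f x = ∫⁻ x in Set.Ioc b (b + T), f x := by
  refine (isAddFundamentalDomain_Ioc hT a).setLIntegral_eq (isAddFundamentalDomain_Ioc hT b) f ?_
  rintro ⟨_, n, rfl⟩ x
  have := hf.zsmul n x
  rwa [add_comm] at this

lemma lintegral_uniformAngle (f : ℝ → ℝ≥0∞) :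
    ∫⁻ x, f x ∂uniformAngle =
      (volume (Set.Ico 0 (2 * Real.pi)))⁻¹ * ∫⁻ x in Set.Ioc 0 (0 + 2 * Real.pi), f x := by
  rw [uniformAngle, ProbabilityTheory.cond, lintegral_smul_measure, smul_eq_mul, zero_add,
    setLIntegral_congr Ico_ae_eq_Ioc]

/-- Angles are real numbers that are not reduced modulo `2π`, so rotation invariance is available
only through periodic functions. -/
lemma lintegral_uniformAngle_add {f : ℝ → ℝ≥0∞} (hf : Function.Periodic f (2 * Real.pi))
    (c : ℝ) : ∫⁻ x, f (x + c) ∂uniformAngle = ∫⁻ x, f x ∂uniformAngle := by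
  rw [lintegral_uniformAngle, lintegral_uniformAngle]
  congr 1
  rw [setLIntegral_Ioc_of_periodic Real.two_pi_pos hf 0 c]
  have h := (measurePreserving_add_right (volume : Measure ℝ) c).setLIntegral_comp_preimage_emb
    (measurableEmbedding_addRight c) f (Set.Ioc c (c + 2 * Real.pi))
  rw [← h]
  congr 2
  ext x
  simp [add_comm]

end Fading

/-! ### The attenuation caused by one interferer -/

lemma measurable_polar : Measurable fun p : ℝ × ℝ => polar p.1 p.2 := by
  unfold polar
  fun_prop

lemma norm_polar {x : ℝ} (hx : 0 ≤ x) (θ : ℝ) : ‖polar x θ‖ = x := by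
  rw [polar, norm_mul, Complex.norm_exp_ofReal_mul_I, mul_one, Complex.norm_real,
    Real.norm_of_nonneg hx]

namespace Params

variable (S : Params)

/-- The factor by which the coverage probability is reduced by a secondary transmitter at `v` with
orientation `o`, when its fading coefficients are `t` (to the primary receiver) and `c` (to the
typical secondary receiver). -/
noncomputable def attenuation (τ : ℝ) (v : ℂ) (o t c : ℝ) : ℝ≥0∞ :=
  expNeg (ENNReal.ofReal (τ / S.A0) * (S.active v o t * ENNReal.ofReal (S.powerAtTypical v o c)))

/-- The mean attenuation caused by a secondary transmitter at `v`. -/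
noncomputable def meanAttenuation (τ : ℝ) (v : ℂ) : ℝ≥0∞ :=
  ∫⁻ o, ∫⁻ t, ∫⁻ c, S.attenuation τ v o t c ∂(expMeasure 1) ∂(expMeasure 1) ∂uniformAngle

/-- The rigid motion that takes displacements from a secondary transmitter with orientation `ω` to
locations in the coordinates of its link. -/
noncomputable def placement (ω : ℝ) (u : ℂ) : ℂ := (u - polar S.rs ω) * polar 1 (Real.pi - ω)

variable {S}

lemma measurable_active (hgst : IsBeamPattern S.gst) (hgpr : IsBeamPattern S.gpr) :
    Measurable fun p : ℂ × ℝ × ℝ => S.active p.1 p.2.1 p.2.2 := by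
  have hst := hgst.measurable
  have hpr := hgpr.measurable
  have hb : Measurable fun p : ℂ × ℝ × ℝ => S.beta p.1 :=
    Complex.measurable_arg.comp (measurable_fst.sub_const _)
  have hp : Measurable fun p : ℂ × ℝ × ℝ => S.powerAtPrimary p.1 p.2.1 p.2.2 := by
    unfold powerAtPrimary zDist
    fun_prop
  exact Measurable.ite (measurableSet_lt hp measurable_const) measurable_const measurable_const

lemma measurable_powerAtTypical (hgst : IsBeamPattern S.gst) (hgsr : IsBeamPattern S.gsr) :
    Measurable fun p : ℂ × ℝ × ℝ => S.powerAtTypical p.1 p.2.1 p.2.2 := by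
  have hst := hgst.measurable
  have hsr := hgsr.measurable
  have ha : Measurable fun p : ℂ × ℝ × ℝ => p.1.arg := Complex.measurable_arg.comp measurable_fst
  unfold powerAtTypical
  fun_prop

lemma measurable_attenuation (hgst : IsBeamPattern S.gst) (hgpr : IsBeamPattern S.gpr)
    (hgsr : IsBeamPattern S.gsr) (τ : ℝ) :
    Measurable fun p : ℂ × ℝ × ℝ × ℝ => S.attenuation τ p.1 p.2.1 p.2.2.1 p.2.2.2 := by
  unfold attenuation
  have h1 := (measurable_active hgst hgpr).comp
    (f := fun p : ℂ × ℝ × ℝ × ℝ => (p.1, p.2.1, p.2.2.1)) (by fun_prop)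
  have h2 := (measurable_powerAtTypical hgst hgsr).comp
    (f := fun p : ℂ × ℝ × ℝ × ℝ => (p.1, p.2.1, p.2.2.2)) (by fun_prop)
  exact measurable_expNeg.comp ((h1.mul h2.ennreal_ofReal).const_mul _)

lemma attenuation_le_one (τ : ℝ) (v : ℂ) (o t c : ℝ) : S.attenuation τ v o t c ≤ 1 :=
  expNeg_le_one _

lemma lintegral_le_one_of_le_one {E : Type*} [MeasurableSpace E] {μ : Measure E}
    [IsProbabilityMeasure μ] {f : E → ℝ≥0∞} (hf : ∀ x, f x ≤ 1) : ∫⁻ x, f x ∂μ ≤ 1 :=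
  (lintegral_mono hf).trans (by simp)

lemma meanAttenuation_le_one (τ : ℝ) (v : ℂ) : S.meanAttenuation τ v ≤ 1 :=
  lintegral_le_one_of_le_one fun _ => lintegral_le_one_of_le_one fun _ =>
    lintegral_le_one_of_le_one fun _ => attenuation_le_one _ _ _ _ _

lemma measurable_lintegral_attenuation (hgst : IsBeamPattern S.gst) (hgpr : IsBeamPattern S.gpr)
    (hgsr : IsBeamPattern S.gsr) (τ : ℝ) :
    Measurable fun p : ℂ × ℝ =>
      ∫⁻ t, ∫⁻ c, S.attenuation τ p.1 p.2 t c ∂(expMeasure 1) ∂(expMeasure 1) := by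
  refine Measurable.lintegral_prod_right' (f := fun q : (ℂ × ℝ) × ℝ =>
    ∫⁻ c, S.attenuation τ q.1.1 q.1.2 q.2 c ∂(expMeasure 1)) ?_
  refine Measurable.lintegral_prod_right' (f := fun q : ((ℂ × ℝ) × ℝ) × ℝ =>
    S.attenuation τ q.1.1.1 q.1.1.2 q.1.2 q.2) ?_
  exact (measurable_attenuation hgst hgpr hgsr τ).comp
    (f := fun q : ((ℂ × ℝ) × ℝ) × ℝ => (q.1.1.1, q.1.1.2, q.1.2, q.2)) (by fun_prop)

lemma measurable_meanAttenuation (hgst : IsBeamPattern S.gst) (hgpr : IsBeamPattern S.gpr)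
    (hgsr : IsBeamPattern S.gsr) (τ : ℝ) : Measurable (S.meanAttenuation τ) :=
  Measurable.lintegral_prod_right' (f := fun q : ℂ × ℝ =>
    ∫⁻ t, ∫⁻ c, S.attenuation τ q.1 q.2 t c ∂(expMeasure 1) ∂(expMeasure 1))
    (measurable_lintegral_attenuation hgst hgpr hgsr τ)

lemma attenuation_periodic (hgst : IsBeamPattern S.gst) (τ : ℝ) (v : ℂ) (t c : ℝ) :
    Function.Periodic (fun o => S.attenuation τ v o t c) (2 * Real.pi) := by
  intro o
  have h (a : ℝ) : S.gst (a - (o + 2 * Real.pi)) = S.gst (a - o) := by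
    rw [← sub_sub]
    exact hgst.periodic.sub_eq _
  have h1 : S.powerAtPrimary v (o + 2 * Real.pi) t = S.powerAtPrimary v o t := by
    simp only [powerAtPrimary, h]
  have h2 : S.powerAtTypical v (o + 2 * Real.pi) c = S.powerAtTypical v o c := by
    simp only [powerAtTypical, h]
  have h3 : S.active v (o + 2 * Real.pi) t = S.active v o t := by
    unfold active
    rw [h1]
  simp only [attenuation, h2, h3]

/-- Used with the shift `π - ω`: whatever the orientation `ω` of the observed link, the orientation
of an interferer relative to it is uniform modulo `2π`. -/
lemma lintegral_attenuation_add (hgst : IsBeamPattern S.gst) (τ : ℝ) (v : ℂ) (a : ℝ) :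
    ∫⁻ o, ∫⁻ t, ∫⁻ c, S.attenuation τ v (o + a) t c ∂(expMeasure 1) ∂(expMeasure 1) ∂uniformAngle =
      S.meanAttenuation τ v := by
  refine lintegral_uniformAngle_add (f := fun o =>
    ∫⁻ t, ∫⁻ c, S.attenuation τ v o t c ∂(expMeasure 1) ∂(expMeasure 1)) (fun o => ?_) a
  exact lintegral_congr fun t => lintegral_congr fun c => attenuation_periodic hgst τ v t c o

lemma measurable_placement : Measurable fun p : ℝ × ℂ => S.placement p.1 p.2 := by
  unfold placement polar
  fun_prop

/-- Zero displacement is the transmitter of the link itself, and `-rs e^(iω) e^(i(π - ω)) = rs`. -/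
lemma placement_zero (ω : ℝ) : S.placement ω 0 = S.typicalTx := by
  rw [placement, typicalTx, polar, polar, polar, zero_sub]
  have h : Complex.exp (((Real.pi - ω : ℝ) : ℂ) * Complex.I) =
      - Complex.exp (-((ω : ℂ) * Complex.I)) := by
    push_cast
    rw [sub_mul, sub_eq_add_neg, Complex.exp_add, Complex.exp_pi_mul_I]
    ring
  rw [h, Complex.exp_neg]
  have := Complex.exp_ne_zero ((ω : ℂ) * Complex.I)
  simp only [Complex.ofReal_one, Complex.ofReal_zero, zero_mul, Complex.exp_zero, one_mul, mul_one]
  field_simp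

end Params

/-! ### The coverage probability given the locations -/

section Conditional

variable {S : Params}

lemma measurable_secondaryInterference {E : Type*} [MeasurableSpace E] {X : ℕ → E → ℂ}
    {mark : Mark → E → ℝ} (hgst : IsBeamPattern S.gst) (hgpr : IsBeamPattern S.gpr)
    (hgsr : IsBeamPattern S.gsr) (hX : ∀ i, Measurable (X i)) (hm : ∀ m, Measurable (mark m))
    (j : ℕ) : Measurable (secondaryInterference S X mark j) := by
  have hr (i : ℕ) : Measurable (relTx S X mark j i) := by
    unfold relTx secondaryRx polar
    fun_prop
  have ho (i : ℕ) : Measurable (relOrientation mark j i) := by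
    unfold relOrientation
    fun_prop
  refine Measurable.tsum fun i => ?_
  exact ((Params.measurable_active hgst hgpr).comp
    (f := fun w => (relTx S X mark j i w, relOrientation mark j i w, mark (.toPrimary i) w))
    (by fun_prop)).mul ((Params.measurable_powerAtTypical hgst hgsr).comp
    (f := fun w => (relTx S X mark j i w, relOrientation mark j i w, mark (.cross i j) w))
    (by fun_prop)).ennreal_ofReal

lemma measurable_activity {E : Type*} [MeasurableSpace E] {X : ℕ → E → ℂ}
    {mark : Mark → E → ℝ} (hgst : IsBeamPattern S.gst) (hgpr : IsBeamPattern S.gpr)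
    (hX : ∀ i, Measurable (X i)) (hm : ∀ m, Measurable (mark m))
    (j : ℕ) : Measurable (activity S X mark j j) := by
  have hr : Measurable (relTx S X mark j j) := by
    unfold relTx secondaryRx polar
    fun_prop
  have ho : Measurable (relOrientation mark j j) := by
    unfold relOrientation
    fun_prop
  exact (Params.measurable_active hgst hgpr).comp
    (f := fun w => (relTx S X mark j j w, relOrientation mark j j w, mark (.toPrimary j) w))
    (by fun_prop)

lemma measurable_primaryInterference : Measurable S.primaryInterference := by
  unfold Params.primaryInterference
  fun_prop

lemma measurable_SINR {E : Type*} [MeasurableSpace E] {X : ℕ → E → ℂ}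
    {mark : Mark → E → ℝ} (hgst : IsBeamPattern S.gst) (hgpr : IsBeamPattern S.gpr)
    (hgsr : IsBeamPattern S.gsr) (hX : ∀ i, Measurable (X i)) (hm : ∀ m, Measurable (mark m))
    (j : ℕ) : Measurable (SINR S X mark j) := by
  have h1 := measurable_secondaryInterference hgst hgpr hgsr hX hm j
  have h2 := measurable_activity hgst hgpr hX hm j
  have h3 := measurable_primaryInterference (S := S)
  unfold SINR
  fun_prop

lemma A0_pos (hps : 0 < S.ps) (hrs : 0 < S.rs) (hst : 0 < S.gst 0) (hsr : 0 < S.gsr 0) :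
    0 < S.A0 := by
  unfold Params.A0
  positivity

/-- The three marks on which the influence of transmitter `i` on link `j` depends; for `i = j`, the
marks on which the activity of transmitter `j` and the primary interference at its receiver
depend. -/
def markBlock (j i : ℕ) : Fin 3 → Mark :=
  ![if i = j then .fromPrimary j else .orientation i, .toPrimary i, .cross i j]

/-- Disjointness of the blocks is what makes their factors independent. The orientation of link `j`
enters every factor and is held fixed, so `fromPrimary j` takes its slot; the entry `cross j j` only
fills the third slot of block `j`. -/
lemma markBlock_injective (j : ℕ) :
    Function.Injective fun p : (Σ _ : ℕ, Fin 3) => markBlock j p.1 p.2 := by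
  rintro ⟨i, k⟩ ⟨i', k'⟩ h
  by_cases hi : i = j <;> by_cases hi' : i' = j <;> fin_cases k <;> fin_cases k' <;>
    simp_all [markBlock]

lemma markBlock_ne_orientation (j i : ℕ) (k : Fin 3) : markBlock j i k ≠ .orientation j := by
  fin_cases k <;> simp [markBlock]
  split_ifs <;> simp [*]

/-- The factor of the conditional coverage probability of link `j` that is contributed by
transmitter `i` at displacement `u` from transmitter `j`, whose orientation is `ω`. -/
noncomputable def blockFactor (S : Params) (τ : ℝ) (j : ℕ) (ω : ℝ) (i : ℕ) (u : ℂ)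
    (z : Fin 3 → ℝ) : ℝ≥0∞ :=
  if i = j then S.active S.typicalTx Real.pi (z 1) *
      expNeg (ENNReal.ofReal (τ / S.A0) * ENNReal.ofReal (S.primaryInterference (z 0)))
  else S.attenuation τ (S.placement ω u) (z 0 + (Real.pi - ω)) (z 1) (z 2)

lemma active_le_one (v : ℂ) (o t : ℝ) : S.active v o t ≤ 1 := by
  unfold Params.active
  split_ifs <;> simp

lemma blockFactor_le_one (τ : ℝ) (j : ℕ) (ω : ℝ) (i : ℕ) (u : ℂ) (z : Fin 3 → ℝ) :
    blockFactor S τ j ω i u z ≤ 1 := by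
  unfold blockFactor
  split_ifs
  · exact mul_le_one' (active_le_one _ _ _) (expNeg_le_one _)
  · exact Params.attenuation_le_one _ _ _ _ _

lemma measurable_blockFactor (hgst : IsBeamPattern S.gst) (hgpr : IsBeamPattern S.gpr)
    (hgsr : IsBeamPattern S.gsr) (τ : ℝ) (j i : ℕ) (u : ℂ) :
    Measurable fun p : ℝ × (Fin 3 → ℝ) => blockFactor S τ j p.1 i u p.2 := by
  unfold blockFactor
  split_ifs
  · have h1 := (Params.measurable_active hgst hgpr).comp
      (f := fun p : ℝ × (Fin 3 → ℝ) => (S.typicalTx, Real.pi, p.2 1)) (by fun_prop)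
    have h2 : Measurable fun p : ℝ × (Fin 3 → ℝ) =>
        ENNReal.ofReal (S.primaryInterference (p.2 0)) :=
      (measurable_primaryInterference.comp (by fun_prop)).ennreal_ofReal
    exact h1.mul (measurable_expNeg.comp (h2.const_mul _))
  · have h := (Params.measurable_placement (S := S)).comp
      (f := fun p : ℝ × (Fin 3 → ℝ) => (p.1, u)) (by fun_prop)
    exact (Params.measurable_attenuation hgst hgpr hgsr τ).comp
      (f := fun p : ℝ × (Fin 3 → ℝ) =>
        (S.placement p.1 u, p.2 0 + (Real.pi - p.1), p.2 1, p.2 2))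
      (Measurable.prodMk h (by fun_prop))

/-- The coverage probability of a link with given locations of all transmitters, for given
values of the marks other than the fading of the link itself. -/
lemma activity_mul_expNeg_eq (τ : ℝ) (x : ℕ → ℂ) (j : ℕ) (m : Mark → ℝ) :
    activity S (fun i _ => x i) (fun k (m : Mark → ℝ) => m k) j j m *
      expNeg (ENNReal.ofReal (τ / S.A0) *
        (ENNReal.ofReal (S.σ ^ 2) + ENNReal.ofReal (S.primaryInterference (m (.fromPrimary j))) +
          secondaryInterference S (fun i _ => x i) (fun k (m : Mark → ℝ) => m k) j m)) =
      expNeg (ENNReal.ofReal (τ / S.A0) * ENNReal.ofReal (S.σ ^ 2)) *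
        infProd fun i => blockFactor S τ j (m (.orientation j)) i (x i - x j)
          fun k => m (markBlock j i k) := by
  set c := ENNReal.ofReal (τ / S.A0)
  set ω := m (.orientation j)
  have hrel (i : ℕ) : relTx S (fun i _ => x i) (fun k (m : Mark → ℝ) => m k) j i m =
      S.placement ω (x i - x j) := by
    rw [relTx, secondaryRx, Params.placement, sub_sub]
  have hact : activity S (fun i _ => x i) (fun k (m : Mark → ℝ) => m k) j j m =
      S.active S.typicalTx Real.pi (m (.toPrimary j)) := by
    rw [activity, hrel, sub_self, Params.placement_zero, relOrientation]
    congr 1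
    ring
  have hsec : expNeg (c * secondaryInterference S (fun i _ => x i) (fun k (m : Mark → ℝ) => m k)
      j m) = infProd (Function.update (fun i => S.attenuation τ (S.placement ω (x i - x j))
        (m (.orientation i) + (Real.pi - ω)) (m (.toPrimary i)) (m (.cross i j))) j 1) := by
    -- The sum over `i ≠ j` is extended by zero to all `i`; the zero term becomes the factor 1 at
    -- index `j`.
    have e : (c * secondaryInterference S (fun i _ => x i) (fun k (m : Mark → ℝ) => m k) j m) =
        ∑' i, ({i | i ≠ j} : Set ℕ).indicator (fun i => c * (S.active (S.placement ω (x i - x j))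
          (m (.orientation i) + (Real.pi - ω)) (m (.toPrimary i)) *
          ENNReal.ofReal (S.powerAtTypical (S.placement ω (x i - x j))
          (m (.orientation i) + (Real.pi - ω)) (m (.cross i j))))) i := by
      rw [← _root_.tsum_subtype, ENNReal.tsum_mul_left, secondaryInterference]
      congr 1
      refine tsum_congr fun i => ?_
      rw [activity, hrel]
      rfl
    rw [e, expNeg_tsum]
    congr 1
    ext i
    rcases eq_or_ne i j with rfl | hij
    · simp
    · rw [Set.indicator_of_mem (by exact hij), Function.update_of_ne hij]
      rfl
  rw [mul_add, mul_add, expNeg_add, expNeg_add, hsec, hact]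
  have hupd : (fun i => blockFactor S τ j ω i (x i - x j) fun k => m (markBlock j i k)) =
      Function.update (fun i => S.attenuation τ (S.placement ω (x i - x j))
        (m (.orientation i) + (Real.pi - ω)) (m (.toPrimary i)) (m (.cross i j))) j
        (S.active S.typicalTx Real.pi (m (.toPrimary j)) *
          expNeg (c * ENNReal.ofReal (S.primaryInterference (m (.fromPrimary j))))) := by
    ext i
    rcases eq_or_ne i j with rfl | hij
    · simp [blockFactor, markBlock, c]
    · simp [blockFactor, markBlock, hij]
  rw [hupd, infProd_update (fun i => Params.attenuation_le_one _ _ _ _ _) j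
    (mul_le_one' (active_le_one _ _ _) (expNeg_le_one _))]
  ring

/-- The factor of the coverage probability that accounts for the activity of the typical
transmitter and for the primary interference. -/
noncomputable def linkFactor (S : Params) (τ : ℝ) : ℝ≥0∞ :=
  (∫⁻ t, S.active S.typicalTx Real.pi t ∂(expMeasure 1)) *
    ∫⁻ y, expNeg (ENNReal.ofReal (τ / S.A0) * ENNReal.ofReal (S.primaryInterference y))
      ∂(expMeasure 1)

lemma linkFactor_le_one (τ : ℝ) : linkFactor S τ ≤ 1 :=
  mul_le_one' (Params.lintegral_le_one_of_le_one fun _ => active_le_one _ _ _)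
    (Params.lintegral_le_one_of_le_one fun _ => expNeg_le_one _)

lemma lintegral_blockFactor (hgst : IsBeamPattern S.gst) (hgpr : IsBeamPattern S.gpr)
    (hgsr : IsBeamPattern S.gsr) (τ : ℝ) (j : ℕ) (ω : ℝ) (i : ℕ) (u : ℂ) :
    ∫⁻ z, blockFactor S τ j ω i u z ∂(Measure.infinitePi fun k => markLaw (markBlock j i k)) =
      if i = j then linkFactor S τ else S.meanAttenuation τ (S.placement ω u) := by
  unfold blockFactor
  split_ifs with hij
  · have h1 : Measurable fun t => S.active S.typicalTx Real.pi t :=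
      (Params.measurable_active hgst hgpr).comp
        (f := fun t : ℝ => (S.typicalTx, Real.pi, t)) (by fun_prop)
    have h2 : Measurable fun y : ℝ =>
        expNeg (ENNReal.ofReal (τ / S.A0) * ENNReal.ofReal (S.primaryInterference y)) :=
      measurable_expNeg.comp (measurable_primaryInterference.ennreal_ofReal.const_mul _)
    rw [lintegral_infinitePi_fin_three (fun k => markLaw (markBlock j i k))
      (φ := fun a b _ => S.active S.typicalTx Real.pi b *
        expNeg (ENNReal.ofReal (τ / S.A0) * ENNReal.ofReal (S.primaryInterference a)))
      ((h1.comp (by fun_prop)).mul (h2.comp (by fun_prop)))]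
    simp only [markBlock, hij, if_true, Matrix.cons_val_zero, Matrix.cons_val_one, Matrix.cons_val,
      markLaw, lintegral_const, measure_univ, mul_one]
    rw [linkFactor, ← lintegral_const_mul _ h2]
    refine lintegral_congr fun a => ?_
    rw [lintegral_mul_const _ h1]
  · rw [lintegral_infinitePi_fin_three (fun k => markLaw (markBlock j i k))
      (φ := fun a b c => S.attenuation τ (S.placement ω u) (a + (Real.pi - ω)) b c)
      ((Params.measurable_attenuation hgst hgpr hgsr τ).comp
        (f := fun p : ℝ × ℝ × ℝ => (S.placement ω u, p.1 + (Real.pi - ω), p.2.1, p.2.2))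
        (by fun_prop))]
    simp only [markBlock, hij, if_false, Matrix.cons_val_zero, Matrix.cons_val_one, Matrix.cons_val,
      markLaw]
    exact Params.lintegral_attenuation_add hgst τ _ _

end Conditional

/-! ### Averaging over the marks for fixed locations, and the mean number of covered links -/

section Coverage

variable {S : Params}

open Classical in
-- A link's own fading enters its SINR only through the numerator, so resampling it leaves activity
-- and interference unchanged.
lemma SINR_update_own (x : ℕ → ℂ) (j : ℕ) (m : Mark → ℝ) (y : ℝ) :
    SINR S (fun i _ => x i) (fun k (m : Mark → ℝ) => m k) j (Function.update m (.own j) y) =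
      ENNReal.ofReal (y * S.A0) *
        activity S (fun i _ => x i) (fun k (m : Mark → ℝ) => m k) j j m /
      (ENNReal.ofReal (S.σ ^ 2) + ENNReal.ofReal (S.primaryInterference (m (.fromPrimary j))) +
        secondaryInterference S (fun i _ => x i) (fun k (m : Mark → ℝ) => m k) j m) := by
  have e : y * S.ps * S.gst 0 * S.gsr 0 * S.rs ^ (-S.α) = y * S.A0 := by
    rw [Params.A0]
    ring
  rw [← e]
  simp [SINR, activity, secondaryInterference, relTx, relOrientation, secondaryRx,
    Function.update_of_ne]

lemma measurable_conditional_product (hgst : IsBeamPattern S.gst) (hgpr : IsBeamPattern S.gpr)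
    (hgsr : IsBeamPattern S.gsr) (τ : ℝ) {E : Type*} [MeasurableSpace E] {X : ℕ → E → ℂ}
    {o : E → ℝ} (hX : ∀ i, Measurable (X i)) (ho : Measurable o) (j : ℕ) :
    Measurable fun w => infProd (Function.update
      (fun i => S.meanAttenuation τ (S.placement (o w) (X i w - X j w))) j 1) :=
  measurable_infProd_update (fun i => (Params.measurable_meanAttenuation hgst hgpr hgsr τ).comp
    (Params.measurable_placement.comp (ho.prodMk ((hX i).sub (hX j))))) j

/-- The event that link `j` is covered, for given locations of the transmitters. -/
def coverageEvent (S : Params) (τ : ℝ) (x : ℕ → ℂ) (j : ℕ) : Set (Mark → ℝ) :=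
  {m | ENNReal.ofReal τ < SINR S (fun i _ => x i) (fun k (m : Mark → ℝ) => m k) j m}

lemma measurableSet_coverageEvent (hgst : IsBeamPattern S.gst) (hgpr : IsBeamPattern S.gpr)
    (hgsr : IsBeamPattern S.gsr) (τ : ℝ) (x : ℕ → ℂ) (j : ℕ) :
    MeasurableSet (coverageEvent S τ x j) :=
  measurableSet_lt measurable_const
    (measurable_SINR hgst hgpr hgsr (fun _ => measurable_const) measurable_pi_apply j)

open Classical in
lemma lintegral_indicator_update_own (hgst : IsBeamPattern S.gst) (hgpr : IsBeamPattern S.gpr)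
    (hgsr : IsBeamPattern S.gsr) {τ : ℝ} (hτ : 0 < τ) (hA0 : 0 < S.A0) (x : ℕ → ℂ) (j : ℕ)
    (m : Mark → ℝ) :
    ∫⁻ y, (coverageEvent S τ x j).indicator 1 (Function.update m (.own j) y)
        ∂(markLaw (.own j)) =
      expNeg (ENNReal.ofReal (τ / S.A0) * ENNReal.ofReal (S.σ ^ 2)) *
        infProd fun i => blockFactor S τ j (m (.orientation j)) i (x i - x j)
          fun k => m (markBlock j i k) := by
  have hE := measurableSet_coverageEvent hgst hgpr hgsr τ x j
  rw [← activity_mul_expNeg_eq]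
  set D := ENNReal.ofReal (S.σ ^ 2) +
    ENNReal.ofReal (S.primaryInterference (m (.fromPrimary j))) +
    secondaryInterference S (fun i _ => x i) (fun k (m : Mark → ℝ) => m k) j m with hD
  set U := activity S (fun i _ => x i) (fun k (m : Mark → ℝ) => m k) j j m with hU
  have h1 : ∫⁻ y, (coverageEvent S τ x j).indicator 1 (Function.update m (.own j) y)
      ∂(markLaw (.own j)) =
      expMeasure 1 {y | ENNReal.ofReal τ < ENNReal.ofReal (y * S.A0) * U / D} := by
    have h2 : {y | ENNReal.ofReal τ < ENNReal.ofReal (y * S.A0) * U / D} =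
        (fun y => Function.update m (.own j) y) ⁻¹' (coverageEvent S τ x j) := by
      ext y
      simp only [coverageEvent, Set.mem_preimage, Set.mem_ofPred_eq, SINR_update_own, hD, hU]
    have h3 : Measurable fun y => Function.update m (.own j) y := measurable_update m
    rw [h2, ← lintegral_indicator_one (h3 hE)]
    rfl
  rw [h1]
  -- An inactive link has SINR 0, also when the denominator is 0; for an active link the exponential
  -- tail applies.
  have hact : U = 0 ∨ U = 1 := by
    simp only [hU, activity, Params.active]
    split_ifs <;> simp
  rcases hact with h | h
  · simp [h]
  · rw [h]
    simp only [mul_one, one_mul]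
    exact expMeasure_lt_div hτ hA0 D

/-- The coverage probability of link `j` for given locations of the transmitters. -/
lemma infinitePi_coverageEvent (hgst : IsBeamPattern S.gst) (hgpr : IsBeamPattern S.gpr)
    (hgsr : IsBeamPattern S.gsr) {τ : ℝ} (hτ : 0 < τ) (hA0 : 0 < S.A0) (x : ℕ → ℂ) (j : ℕ) :
    Measure.infinitePi markLaw (coverageEvent S τ x j) =
      expNeg (ENNReal.ofReal (τ / S.A0) * ENNReal.ofReal (S.σ ^ 2)) * linkFactor S τ *
        ∫⁻ ω, infProd (Function.update
          (fun i => S.meanAttenuation τ (S.placement ω (x i - x j))) j 1) ∂uniformAngle := by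
  classical
  have hE := measurableSet_coverageEvent hgst hgpr hgsr τ x j
  set g : (Mark → ℝ) → ℝ≥0∞ := fun m =>
    infProd fun i => blockFactor S τ j (m (.orientation j)) i (x i - x j)
      fun k => m (markBlock j i k)
  have hgm : Measurable fun p : ℝ × (Mark → ℝ) => infProd fun i =>
      blockFactor S τ j p.1 i (x i - x j) fun k => p.2 (markBlock j i k) :=
    measurable_infProd fun i => (measurable_blockFactor hgst hgpr hgsr τ j i (x i - x j)).comp
      (f := fun p : ℝ × (Mark → ℝ) => (p.1, fun k => p.2 (markBlock j i k))) (by fun_prop)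
  have hg : Measurable g := hgm.comp (f := fun m : Mark → ℝ => (m (.orientation j), m))
    (by fun_prop)
  have hgu (m : Mark → ℝ) (ω : ℝ) : g (Function.update m (.orientation j) ω) =
      infProd fun i => blockFactor S τ j ω i (x i - x j) fun k => m (markBlock j i k) := by
    simp only [g, Function.update_self, Function.update_of_ne (markBlock_ne_orientation j _ _)]
  -- The own fading is integrated out first, then the orientation of link `j` is split off, so that
  -- the remaining marks can be averaged block by block for each fixed `ω`.
  rw [← lintegral_indicator_one hE,
    lintegral_infinitePi_update markLaw (.own j) (measurable_one.indicator hE)]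
  simp_rw [lintegral_indicator_update_own hgst hgpr hgsr hτ hA0]
  rw [lintegral_const_mul _ hg, lintegral_infinitePi_update markLaw (.orientation j) hg]
  simp_rw [hgu]
  have hgs : Measurable (Function.uncurry fun (m : Mark → ℝ) (ω : ℝ) => infProd fun i =>
      blockFactor S τ j ω i (x i - x j) fun k => m (markBlock j i k)) :=
    hgm.comp (f := fun p : (Mark → ℝ) × ℝ => (p.2, p.1)) (by fun_prop)
  have hm : Measurable fun ω => infProd (Function.update
      (fun i => S.meanAttenuation τ (S.placement ω (x i - x j))) j 1) :=
    measurable_conditional_product hgst hgpr hgsr τ (X := fun i _ => x i) (o := fun ω => ω)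
      (fun i => measurable_const) measurable_id j
  have hω (ω : ℝ) : ∫⁻ m, infProd (fun i => blockFactor S τ j ω i (x i - x j)
      fun k => m (markBlock j i k)) ∂(Measure.infinitePi markLaw) =
      linkFactor S τ * infProd (Function.update
        (fun i => S.meanAttenuation τ (S.placement ω (x i - x j))) j 1) := by
    rw [lintegral_infProd_blocks markLaw (markBlock j) (markBlock_injective j)
      (ψ := fun i z => blockFactor S τ j ω i (x i - x j) z)
      (fun i => (measurable_blockFactor hgst hgpr hgsr τ j i (x i - x j)).comp
        (f := fun z : Fin 3 → ℝ => (ω, z)) (by fun_prop))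
      fun i z => blockFactor_le_one _ _ _ _ _ _]
    simp_rw [lintegral_blockFactor hgst hgpr hgsr]
    rw [← infProd_update (fun i => Params.meanAttenuation_le_one _ _) j (linkFactor_le_one τ)]
    congr 1
    ext i
    rcases eq_or_ne i j with rfl | hij <;> simp [*]
  rw [lintegral_lintegral_swap hgs.aemeasurable, mul_assoc]
  simp_rw [hω]
  rw [lintegral_const_mul _ hm]
  rfl

/-- The marks are only assumed almost everywhere measurable, and joint measurability in that sense
requires a countable family. -/
instance : Countable Mark := by
  let f : Mark → ℕ × ℕ × ℕ
    | .orientation i => (0, i, 0)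
    | .own i => (1, i, 0)
    | .toPrimary i => (2, i, 0)
    | .fromPrimary j => (3, j, 0)
    | .cross i j => (4, i, j)
  have hf : Function.Injective f := by
    rintro (_ | _ | _ | _ | _) (_ | _ | _ | _ | _) h <;> simp_all [f]
  exact hf.countable

variable {Ω : Type*} [MeasurableSpace Ω] {P : Measure Ω} [IsProbabilityMeasure P]
  {X : ℕ → Ω → ℂ} {mark : Mark → Ω → ℝ} {lam : ℝ}

lemma IsSecondaryNetwork.map_eq (hnet : IsSecondaryNetwork P X mark lam) :
    P.map (fun w => ((fun i => X i w), fun m => mark m w)) =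
      (P.map fun w i => X i w).prod (Measure.infinitePi markLaw) := by
  have hm : AEMeasurable (fun w m => mark m w) P :=
    aemeasurable_pi_iff.2 fun m => (hnet.law m).aemeasurable
  have hX : AEMeasurable (fun w i => X i w) P :=
    (measurable_pi_lambda _ hnet.locations.measurable).aemeasurable
  rw [(indepFun_iff_map_prod_eq_prod_map_map hX hm).1 hnet.indep_locations,
    (hnet.indep_marks.hasLaw_infinitePi hnet.law hm).map_eq]

/-- The mean number of covered links in the window `B`. -/
lemma IsSecondaryNetwork.lintegral_encard (hnet : IsSecondaryNetwork P X mark lam)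
    (hgst : IsBeamPattern S.gst) (hgpr : IsBeamPattern S.gpr)
    (hgsr : IsBeamPattern S.gsr) {τ : ℝ} (hτ : 0 < τ) (hA0 : 0 < S.A0)
    {B : Set ℂ} (hB : MeasurableSet B) :
    ∫⁻ w, ((Set.encard {j : ℕ | X j w ∈ B ∧ w ∈ {w | ENNReal.ofReal τ < SINR S X mark j w}} : ℕ∞) :
        ℝ≥0∞) ∂P =
      expNeg (ENNReal.ofReal (τ / S.A0) * ENNReal.ofReal (S.σ ^ 2)) * linkFactor S τ *
        ∫⁻ ω, palmProduct P X B (fun x u => S.meanAttenuation τ (S.placement ω (u - x)))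
          ∂uniformAngle := by
  set K := expNeg (ENNReal.ofReal (τ / S.A0) * ENNReal.ofReal (S.σ ^ 2)) * linkFactor S τ
  let F : ℕ → (ℕ → ℂ) × (Mark → ℝ) → ℝ≥0∞ := fun j p => B.indicator 1 (p.1 j) *
    {p : (ℕ → ℂ) × (Mark → ℝ) | ENNReal.ofReal τ <
      SINR S (fun i p => p.1 i) (fun k p => p.2 k) j p}.indicator 1 p
  have hE (j : ℕ) : MeasurableSet {p : (ℕ → ℂ) × (Mark → ℝ) | ENNReal.ofReal τ <
      SINR S (fun i p => p.1 i) (fun k p => p.2 k) j p} :=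
    measurableSet_lt measurable_const
      (measurable_SINR hgst hgpr hgsr (fun i => by fun_prop) (fun k => by fun_prop) j)
  have hF (j : ℕ) : Measurable (F j) :=
    ((measurable_one.indicator hB).comp (by fun_prop)).mul (measurable_one.indicator (hE j))
  have hmap : AEMeasurable (fun w => ((fun i => X i w), fun m => mark m w)) P :=
    (measurable_pi_lambda _ hnet.locations.measurable).aemeasurable.prodMk
      (aemeasurable_pi_iff.2 fun m => (hnet.law m).aemeasurable)
  have hXm : Measurable fun w i => X i w := measurable_pi_lambda _ hnet.locations.measurable
  have h1 : ∫⁻ w, ((Set.encard {j : ℕ | X j w ∈ B ∧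
      w ∈ {w | ENNReal.ofReal τ < SINR S X mark j w}} : ℕ∞) : ℝ≥0∞) ∂P =
      ∫⁻ p, ∑' j, F j p ∂(P.map fun w => ((fun i => X i w), fun m => mark m w)) := by
    rw [lintegral_map' (Measurable.tsum hF).aemeasurable hmap]
    refine lintegral_congr fun w => ?_
    rw [toENNReal_encard_eq_tsum]
    refine tsum_congr fun j => ?_
    -- The SINR depends on the sample point only through locations and marks, so the computation
    -- moves to their joint law.
    have hS : SINR S (fun i (p : (ℕ → ℂ) × (Mark → ℝ)) => p.1 i) (fun k p => p.2 k) j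
        ((fun i => X i w), fun m => mark m w) = SINR S X mark j w := rfl
    by_cases hb : X j w ∈ B <;> by_cases hs : ENNReal.ofReal τ < SINR S X mark j w <;>
      simp [F, hb, hs, hS]
  have h2 (x : ℕ → ℂ) (j : ℕ) : ∫⁻ m, F j (x, m) ∂(Measure.infinitePi markLaw) =
      K * ∫⁻ ω, B.indicator 1 (x j) * infProd (Function.update
          (fun i => S.meanAttenuation τ (S.placement ω (x i - x j))) j 1) ∂uniformAngle := by
    have hc : Measurable fun ω => infProd (Function.update
        (fun i => S.meanAttenuation τ (S.placement ω (x i - x j))) j 1) :=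
      measurable_conditional_product hgst hgpr hgsr τ (fun i => measurable_const) measurable_id j
    rw [lintegral_const_mul _ hc, mul_left_comm, ← infinitePi_coverageEvent hgst hgpr hgsr hτ hA0 x j]
    have hs := measurableSet_coverageEvent hgst hgpr hgsr τ x j
    rw [← lintegral_indicator_one hs, ← lintegral_const_mul _ (measurable_one.indicator hs)]
    rfl
  have hmeas (j : ℕ) : Measurable fun p : (ℕ → ℂ) × ℝ => B.indicator (1 : ℂ → ℝ≥0∞) (p.1 j) *
      infProd (Function.update
        (fun i => S.meanAttenuation τ (S.placement p.2 (p.1 i - p.1 j))) j 1) :=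
    ((measurable_one.indicator hB).comp (by fun_prop)).mul
      (measurable_conditional_product hgst hgpr hgsr τ (X := fun i (p : (ℕ → ℂ) × ℝ) => p.1 i)
        (o := fun p => p.2) (fun i => by fun_prop) (by fun_prop) j)
  have hsum : Measurable fun p : (ℕ → ℂ) × ℝ => ∑' j, B.indicator (1 : ℂ → ℝ≥0∞) (p.1 j) *
      infProd (Function.update
        (fun i => S.meanAttenuation τ (S.placement p.2 (p.1 i - p.1 j))) j 1) :=
    Measurable.tsum hmeas
  have h3 (x : ℕ → ℂ) : ∫⁻ m, ∑' j, F j (x, m) ∂(Measure.infinitePi markLaw) =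
      K * ∫⁻ ω, ∑' j, B.indicator 1 (x j) * infProd (Function.update
          (fun i => S.meanAttenuation τ (S.placement ω (x i - x j))) j 1) ∂uniformAngle := by
    have hF' (j : ℕ) : Measurable fun m => F j (x, m) := (hF j).comp measurable_prodMk_left
    have hmeas' (j : ℕ) : Measurable fun ω => B.indicator (1 : ℂ → ℝ≥0∞) (x j) *
        infProd (Function.update
          (fun i => S.meanAttenuation τ (S.placement ω (x i - x j))) j 1) :=
      (hmeas j).comp measurable_prodMk_left
    rw [lintegral_tsum fun j => (hF' j).aemeasurable,
      lintegral_tsum fun j => (hmeas' j).aemeasurable, ← ENNReal.tsum_mul_left]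
    exact tsum_congr fun j => h2 x j
  rw [h1, hnet.map_eq, lintegral_prod _ (Measurable.tsum hF).aemeasurable]
  simp_rw [h3]
  rw [lintegral_map (Measurable.const_mul (Measurable.lintegral_prod_right' hsum) K) hXm]
  refine (lintegral_const_mul _ ((Measurable.lintegral_prod_right' hsum).comp hXm)).trans ?_
  congr 1
  -- With the orientation integral outermost, the inner integral over the locations is a
  -- `palmProduct` for each fixed `ω`.
  exact lintegral_lintegral_swap (f := fun w ω => ∑' j, B.indicator (1 : ℂ → ℝ≥0∞) (X j w) *
      infProd (Function.update
        (fun i => S.meanAttenuation τ (S.placement ω (X i w - X j w))) j 1))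
    (hsum.comp (f := fun p : Ω × ℝ => ((fun i => X i p.1), p.2))
      ((hXm.comp measurable_fst).prodMk measurable_snd)).aemeasurable

end Coverage

/-! ### Evaluation of the terms of the formula -/

section Evaluation

variable {S : Params}

lemma one_sub_lintegral {E : Type*} [MeasurableSpace E] {μ : Measure E} [IsProbabilityMeasure μ]
    {f : E → ℝ≥0∞} (hf : Measurable f) (hf1 : ∀ x, f x ≤ 1) :
    1 - ∫⁻ x, f x ∂μ = ∫⁻ x, (1 - f x) ∂μ := by
  rw [lintegral_sub hf ((lintegral_mono hf1).trans_lt (by simp)).ne (ae_of_all _ hf1)]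
  simp

/-- The power at the primary receiver from a secondary transmitter at `v` with orientation `o`, for
unit fading. -/
noncomputable def primaryGain (S : Params) (v : ℂ) (o : ℝ) : ℝ :=
  S.ps * S.gst (S.beta v - o) * S.gpr (S.ωp - S.beta v) * S.zDist v ^ (-S.α)

lemma zDist_nonneg (v : ℂ) : 0 ≤ S.zDist v := norm_nonneg _

lemma primaryGain_nonneg (hps : 0 < S.ps) (hgst : IsBeamPattern S.gst)
    (hgpr : IsBeamPattern S.gpr) (v : ℂ) (o : ℝ) : 0 ≤ primaryGain S v o :=
  mul_nonneg (mul_nonneg (mul_nonneg hps.le (hgst.nonneg _)) (hgpr.nonneg _))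
    (Real.rpow_nonneg (zDist_nonneg v) _)

/-- The probability that a secondary transmitter at `v` with orientation `o` is active. -/
lemma lintegral_active (hps : 0 < S.ps) (hρ : 0 < S.ρ) (hgst : IsBeamPattern S.gst)
    (hgpr : IsBeamPattern S.gpr) (v : ℂ) (o : ℝ) :
    ∫⁻ t, S.active v o t ∂(expMeasure 1) =
      1 - expNeg (ENNReal.ofReal S.ρ / ENNReal.ofReal (primaryGain S v o)) := by
  rw [← expMeasure_mul_lt (primaryGain_nonneg hps hgst hgpr v o) hρ, ← lintegral_indicator_one]
  · refine lintegral_congr fun t => ?_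
    have e : S.powerAtPrimary v o t = t * primaryGain S v o := by
      rw [Params.powerAtPrimary, primaryGain]
      ring
    unfold Params.active
    rw [e]
    by_cases h : t * primaryGain S v o < S.ρ <;> simp [h]
  · exact measurableSet_lt (by fun_prop) measurable_const

/-- The primary receiver has to be excluded: there, for `α ≠ 0`, the convention `0 ^ (-α) = 0` makes
the gain zero and the left side infinite when `ρ > 0`, while the right side contains the factor `0 ^
α = 0`. -/
lemma ofReal_rho_div_primaryGain (hps : 0 < S.ps) (hgst : IsBeamPattern S.gst)
    (hgpr : IsBeamPattern S.gpr) {x θ : ℝ} (hne : polar x θ ≠ S.primaryRx) (o : ℝ) :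
    ENNReal.ofReal S.ρ / ENNReal.ofReal (primaryGain S (polar x θ) o) =
      S.As o x θ * ENNReal.ofReal (S.zDist (polar x θ) ^ S.α) := by
  have hz : 0 < S.zDist (polar x θ) := norm_pos_iff.2 (sub_ne_zero.2 hne)
  have hza : 0 < S.zDist (polar x θ) ^ S.α := Real.rpow_pos_of_pos hz _
  rw [primaryGain, Real.rpow_neg hz.le, Params.As,
    ENNReal.ofReal_mul (mul_nonneg (mul_nonneg hps.le (hgst.nonneg _)) (hgpr.nonneg _)),
    ENNReal.ofReal_inv_of_pos hza, div_eq_mul_inv, div_eq_mul_inv,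
    ENNReal.mul_inv (Or.inr (by simp [hza])) (Or.inr (by simp)), inv_inv]
  exact (mul_assoc _ _ _).symm

lemma one_div_ofReal_A1 (hρ : 0 < S.ρ) :
    1 / ENNReal.ofReal S.A1 =
      ENNReal.ofReal S.ρ / ENNReal.ofReal (primaryGain S S.typicalTx Real.pi) := by
  have e : S.A1 = primaryGain S S.typicalTx Real.pi / S.ρ := rfl
  rw [e, ENNReal.ofReal_div_of_pos hρ, one_div, ENNReal.inv_div (Or.inl ENNReal.ofReal_ne_top)
    (Or.inl (by simpa using hρ))]

/-- The numerator is the probability that the typical transmitter is active; the denominator comes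
from the Laplace transform of the primary interference at `τ / A0`. -/
lemma linkFactor_eq {τ : ℝ} (hτ : 0 < τ) (hA0 : 0 < S.A0) (hpp : 0 < S.pp) (hps : 0 < S.ps)
    (hρ : 0 < S.ρ) (hxp : 0 < S.xp) (hgpt : IsBeamPattern S.gpt) (hgpr : IsBeamPattern S.gpr)
    (hgst : IsBeamPattern S.gst) (hgsr : IsBeamPattern S.gsr) :
    linkFactor S τ = (1 - expNeg (1 / ENNReal.ofReal S.A1)) /
      ENNReal.ofReal (1 + τ * (S.A2 / S.A0)) := by
  have hA2 : 0 ≤ S.A2 := mul_nonneg (mul_nonneg (mul_nonneg hpp.le (hgpt.nonneg _))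
    (hgsr.nonneg _)) (Real.rpow_nonneg hxp.le _)
  have hq : 0 ≤ τ * (S.A2 / S.A0) := by positivity
  have e (y : ℝ) : ENNReal.ofReal (τ / S.A0) * ENNReal.ofReal (S.primaryInterference y) =
      ENNReal.ofReal (y * (τ * (S.A2 / S.A0))) := by
    rw [← ENNReal.ofReal_mul (by positivity), Params.primaryInterference, Params.primaryTx,
      norm_polar hxp.le, Params.A2]
    congr 1
    ring
  rw [linkFactor, lintegral_active hps hρ hgst hgpr, one_div_ofReal_A1 hρ]
  simp_rw [e]
  rw [lintegral_expNeg_expMeasure hq, ENNReal.ofReal_add zero_le_one hq, ENNReal.ofReal_one]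
  exact (div_eq_mul_inv _ _).symm

/-- Together with periodicity of the beam patterns, this allows the principal argument to be
replaced by `θ`. -/
lemma exists_arg_polar {x : ℝ} (hx : 0 < x) (θ : ℝ) :
    ∃ n : ℤ, (polar x θ).arg = θ - n • (2 * Real.pi) := by
  refine ⟨toIocDiv Real.two_pi_pos (-Real.pi) θ, ?_⟩
  rw [polar, Complex.arg_real_mul _ hx, Complex.arg_exp_mul_I]
  rfl

lemma powerAtTypical_polar (hgst : IsBeamPattern S.gst) (hgsr : IsBeamPattern S.gsr) {x : ℝ}
    (hx : 0 < x) (θ o c : ℝ) :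
    S.powerAtTypical (polar x θ) o c =
      c * S.ps * S.gsr θ * S.gst (θ - o - Real.pi) * x ^ (-S.α) := by
  obtain ⟨n, hn⟩ := exists_arg_polar hx θ
  have h1 : S.gsr (polar x θ).arg = S.gsr θ := by
    rw [hn]
    exact hgsr.periodic.sub_zsmul_eq n
  have h2 : S.gst ((polar x θ).arg - Real.pi - o) = S.gst (θ - o - Real.pi) := by
    rw [hn, show θ - n • (2 * Real.pi) - Real.pi - o = θ - o - Real.pi - n • (2 * Real.pi) by ring]
    exact hgst.periodic.sub_zsmul_eq n
  rw [Params.powerAtTypical, h1, h2, norm_polar hx.le]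

/-- The relative loss of signal caused by an active interferer at `x ∠ θ`. -/
lemma one_sub_inv_one_add {τ : ℝ} (hτ : 0 < τ) (hA0 : 0 < S.A0) (hps : 0 < S.ps)
    (hgst : IsBeamPattern S.gst) (hgsr : IsBeamPattern S.gsr) {x : ℝ} (hx : 0 < x) (θ o : ℝ) :
    1 - (1 + ENNReal.ofReal (τ / S.A0 * (S.ps * S.gsr θ * S.gst (θ - o - Real.pi) *
        x ^ (-S.α))))⁻¹ =
      (1 + S.Cs τ o θ * ENNReal.ofReal (x ^ S.α))⁻¹ := by
  have hxa : 0 < x ^ S.α := Real.rpow_pos_of_pos hx _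
  set k := S.gst (θ - o - Real.pi) * S.gsr θ with hk
  have hk0 : 0 ≤ k := mul_nonneg (hgst.nonneg _) (hgsr.nonneg _)
  have e1 : τ / S.A0 * (S.ps * S.gsr θ * S.gst (θ - o - Real.pi) * x ^ (-S.α)) =
      τ * S.ps * k / (S.A0 * x ^ S.α) := by
    rw [Real.rpow_neg hx.le]
    field_simp
    rw [hk]
    ring
  have e2 : S.Cs τ o θ = ENNReal.ofReal S.A0 / ENNReal.ofReal (τ * S.ps * k) := by
    rw [Params.Cs, hk, mul_assoc (τ * S.ps)]
  rw [e1, e2]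
  -- If the gain vanishes, `C_s = ∞` and both sides are 0.
  rcases hk0.eq_or_lt with h | h
  · rw [← h]
    simp [ENNReal.div_zero, hA0, hxa]
  · have hp : 0 < τ * S.ps * k := by positivity
    rw [← ENNReal.ofReal_div_of_pos hp, ← ENNReal.ofReal_mul (by positivity), ← ENNReal.ofReal_one,
      ← ENNReal.ofReal_add zero_le_one (by positivity),
      ← ENNReal.ofReal_add zero_le_one (by positivity),
      ← ENNReal.ofReal_inv_of_pos (by positivity), ← ENNReal.ofReal_inv_of_pos (by positivity),
      ← ENNReal.ofReal_sub _ (by positivity)]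
    congr 1
    field_simp
    ring

/-- An inactive interferer causes no loss; for an active one the loss is one minus the Laplace
transform of the exponential fading. -/
lemma lintegral_attenuation_cross {τ : ℝ} (hτ : 0 < τ) (hA0 : 0 < S.A0) (hps : 0 < S.ps)
    (hgst : IsBeamPattern S.gst) (hgsr : IsBeamPattern S.gsr) {x : ℝ} (hx : 0 < x) (θ o t : ℝ) :
    1 - ∫⁻ c, S.attenuation τ (polar x θ) o t c ∂(expMeasure 1) =
      S.active (polar x θ) o t * (1 + S.Cs τ o θ * ENNReal.ofReal (x ^ S.α))⁻¹ := by
  have hact : S.active (polar x θ) o t = 0 ∨ S.active (polar x θ) o t = 1 := by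
    unfold Params.active
    split_ifs <;> simp
  unfold Params.attenuation
  rcases hact with h | h
  · simp [h]
  · have hq : 0 ≤ τ / S.A0 * (S.ps * S.gsr θ * S.gst (θ - o - Real.pi) * x ^ (-S.α)) :=
      mul_nonneg (by positivity) (mul_nonneg (mul_nonneg (mul_nonneg hps.le (hgsr.nonneg _))
        (hgst.nonneg _)) (Real.rpow_nonneg hx.le _))
    have e (c : ℝ) : ENNReal.ofReal (τ / S.A0) *
        (1 * ENNReal.ofReal (S.powerAtTypical (polar x θ) o c)) =
        ENNReal.ofReal (c * (τ / S.A0 *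
          (S.ps * S.gsr θ * S.gst (θ - o - Real.pi) * x ^ (-S.α)))) := by
      rw [powerAtTypical_polar hgst hgsr hx, one_mul, ← ENNReal.ofReal_mul (by positivity)]
      congr 1
      ring
    rw [h]
    simp_rw [e]
    rw [lintegral_expNeg_expMeasure hq, one_sub_inv_one_add hτ hA0 hps hgst hgsr hx, one_mul]

/-- Given the orientation, activity depends on one fading coefficient and interference power on
another, so the mean loss is the product of the activity probability and the loss when active. -/
lemma one_sub_meanAttenuation {τ : ℝ} (hτ : 0 < τ) (hA0 : 0 < S.A0) (hps : 0 < S.ps)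
    (hρ : 0 < S.ρ) (hgpr : IsBeamPattern S.gpr) (hgst : IsBeamPattern S.gst)
    (hgsr : IsBeamPattern S.gsr) {x θ : ℝ} (hx : 0 < x) (hne : polar x θ ≠ S.primaryRx) :
    1 - S.meanAttenuation τ (polar x θ) =
      ∫⁻ o, (1 - expNeg (S.As o x θ * ENNReal.ofReal (S.zDist (polar x θ) ^ S.α))) /
        (1 + S.Cs τ o θ * ENNReal.ofReal (x ^ S.α)) ∂uniformAngle := by
  have hm := Params.measurable_attenuation hgst hgpr hgsr τ
  have m1 : Measurable fun o : ℝ => ∫⁻ t, ∫⁻ c, S.attenuation τ (polar x θ) o t c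
      ∂(expMeasure 1) ∂(expMeasure 1) :=
    (Params.measurable_lintegral_attenuation hgst hgpr hgsr τ).comp
      (f := fun o : ℝ => (polar x θ, o)) (by fun_prop)
  have m2 (o : ℝ) : Measurable fun t : ℝ => ∫⁻ c, S.attenuation τ (polar x θ) o t c
      ∂(expMeasure 1) :=
    Measurable.lintegral_prod_right' (f := fun p : ℝ × ℝ => S.attenuation τ (polar x θ) o p.1 p.2)
      (hm.comp (f := fun p : ℝ × ℝ => (polar x θ, o, p.1, p.2)) (by fun_prop))
  have m3 (o : ℝ) : Measurable fun t : ℝ => S.active (polar x θ) o t :=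
    (Params.measurable_active hgst hgpr).comp (f := fun t : ℝ => (polar x θ, o, t)) (by fun_prop)
  rw [Params.meanAttenuation, one_sub_lintegral m1 fun o =>
    Params.lintegral_le_one_of_le_one fun t => Params.lintegral_le_one_of_le_one fun c =>
      Params.attenuation_le_one _ _ _ _ _]
  refine lintegral_congr fun o => ?_
  rw [one_sub_lintegral (m2 o) fun t => Params.lintegral_le_one_of_le_one fun c =>
      Params.attenuation_le_one _ _ _ _ _]
  simp_rw [lintegral_attenuation_cross hτ hA0 hps hgst hgsr hx]
  rw [lintegral_mul_const _ (m3 o), lintegral_active hps hρ hgst hgpr,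
    ofReal_rho_div_primaryGain hps hgst hgpr hne, div_eq_mul_inv]

/-- Integration over the plane in polar coordinates with angles in `(0, 2π)`. -/
lemma lintegral_eq_lintegral_polar {f : ℂ → ℝ≥0∞} (hf : Measurable f) :
    ∫⁻ v, f v = ∫⁻ θ in Set.Ioo 0 (2 * Real.pi), ∫⁻ x in Set.Ioi (0 : ℝ),
      f (polar x θ) * ENNReal.ofReal x := by
  have hp (p : ℝ × ℝ) : Complex.polarCoord.symm p = polar p.1 p.2 := by
    rw [Complex.polarCoord_symm_apply, polar, Complex.exp_mul_I]
    push_cast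
    rfl
  have hm : Measurable fun p : ℝ × ℝ => f (polar p.1 p.2) * ENNReal.ofReal p.1 :=
    (hf.comp measurable_polar).mul (by fun_prop)
  have hper : Function.Periodic (fun θ => ∫⁻ x in Set.Ioi (0 : ℝ),
      f (polar x θ) * ENNReal.ofReal x) (2 * Real.pi) := by
    intro θ
    have : ∀ x, polar x (θ + 2 * Real.pi) = polar x θ := fun x => by
      unfold polar
      push_cast
      rw [add_mul, Complex.exp_add, Complex.exp_two_pi_mul_I, mul_one]
    simp only [this]
  rw [← Complex.lintegral_comp_polarCoord_symm, polarCoord_target, Measure.volume_eq_prod,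
    ← Measure.prod_restrict]
  simp_rw [hp, smul_eq_mul, mul_comm (ENNReal.ofReal _)]
  rw [lintegral_prod_symm' _ hm, setLIntegral_congr Ioo_ae_eq_Ioc,
    setLIntegral_congr (Ioo_ae_eq_Ioc (a := (0 : ℝ)))]
  -- The polar chart uses angles in `(-π, π)`; periodicity moves them to `(0, 2π)`.
  have h := setLIntegral_Ioc_of_periodic Real.two_pi_pos hper (-Real.pi) 0
  rw [zero_add, show -Real.pi + 2 * Real.pi = Real.pi by ring] at h
  exact h

lemma lintegral_one_sub_meanAttenuation {τ : ℝ} (hτ : 0 < τ) (hα : 0 < S.α) (hA0 : 0 < S.A0)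
    (hps : 0 < S.ps) (hρ : 0 < S.ρ) (hgpr : IsBeamPattern S.gpr) (hgst : IsBeamPattern S.gst)
    (hgsr : IsBeamPattern S.gsr) :
    ∫⁻ v, (1 - S.meanAttenuation τ v) = S.interferenceIntegral τ := by
  classical
  have hm : Measurable fun v => 1 - S.meanAttenuation τ v :=
    measurable_const.sub (Params.measurable_meanAttenuation hgst hgpr hgsr τ)
  -- The primary receiver is a single point of area zero, so the integrand may be set to zero there.
  have h1 : ∫⁻ v, (1 - S.meanAttenuation τ v) =
      ∫⁻ v, ({S.primaryRx}ᶜ : Set ℂ).indicator (fun v => 1 - S.meanAttenuation τ v) v := by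
    refine lintegral_congr_ae ?_
    filter_upwards [compl_mem_ae_iff.2 (measure_singleton (μ := volume) S.primaryRx)] with v hv
    rw [Set.indicator_of_mem hv]
  rw [h1, lintegral_eq_lintegral_polar (hm.indicator (measurableSet_singleton _).compl),
    Params.interferenceIntegral]
  refine lintegral_congr fun θ => setLIntegral_congr_fun measurableSet_Ioi fun x hx => ?_
  congr 1
  -- At the primary receiver the formula also gives zero: `z ^ α = 0` because `α > 0`, and `As * 0 =
  -- 0` even if `As = ∞`.
  by_cases hne : polar x θ = S.primaryRx
  · rw [Set.indicator_of_notMem (by simpa using hne)]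
    have hz : S.zDist (polar x θ) = 0 := by simp [Params.zDist, hne]
    simp [hz, Real.zero_rpow hα.ne']
  · rw [Set.indicator_of_mem (by simpa using hne)]
    exact one_sub_meanAttenuation hτ hA0 hps hρ hgpr hgst hgsr hx hne

lemma measurePreserving_placement (ω : ℝ) : MeasurePreserving (S.placement ω) := by
  have h1 : MeasurePreserving (fun u : ℂ => u - polar S.rs ω) :=
    measurePreserving_sub_right volume _
  have h2 := (rotation (Circle.exp (Real.pi - ω))).measurePreserving
  convert! h2.comp h1 using 1
  ext u
  simp only [Params.placement, Function.comp_apply, rotation_apply, Circle.coe_exp, polar,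
    Complex.ofReal_one, one_mul]
  rw [mul_comm]

end Evaluation

end CognitiveNetwork

open CognitiveNetwork in
theorem theorem3 {Ω : Type*} [MeasurableSpace Ω] (P : MeasureTheory.Measure Ω)
    [MeasureTheory.IsProbabilityMeasure P]
    (X : ℕ → Ω → ℂ) (mark : CognitiveNetwork.Mark → Ω → ℝ) (lam τ : ℝ)
    (S : CognitiveNetwork.Params)
    (hlam : 0 < lam) (hτ : 0 < τ)
    (hα : 0 < S.α) (hpp : 0 < S.pp) (hps : 0 < S.ps) (hρ : 0 < S.ρ)
    (hrs : 0 < S.rs) (hrp : 0 < S.rp) (hxp : 0 < S.xp)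
    (hne : S.typicalTx ≠ S.primaryRx)
    (hgpt : CognitiveNetwork.IsBeamPattern S.gpt) (hgpr : CognitiveNetwork.IsBeamPattern S.gpr)
    (hgst : CognitiveNetwork.IsBeamPattern S.gst) (hgsr : CognitiveNetwork.IsBeamPattern S.gsr)
    (hst : 0 < S.gst 0) (hsr : 0 < S.gsr 0)
    (hnet : CognitiveNetwork.IsSecondaryNetwork P X mark lam)
    (B : Set ℂ) (hB : MeasurableSet B) (hB0 : 0 < MeasureTheory.volume B)
    (hB1 : MeasureTheory.volume B < ⊤) :
    CognitiveNetwork.coverageProb S X mark P lam τ B =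
      ENNReal.ofReal (Real.exp (-(τ * S.σ ^ 2 / S.A0))) *
        ((1 - CognitiveNetwork.expNeg (1 / ENNReal.ofReal S.A1)) /
          ENNReal.ofReal (1 + τ * (S.A2 / S.A0))) *
        CognitiveNetwork.expNeg (ENNReal.ofReal lam * S.interferenceIntegral τ) := by
  have hA0 : 0 < S.A0 := A0_pos hps hrs hst hsr
  -- Rigid motions preserve area, so the value is the same for every `ω` and the final average over
  -- the orientation is trivial.
  have hpalm (ω : ℝ) :
      palmProduct P X B (fun x u => S.meanAttenuation τ (S.placement ω (u - x))) =
        ENNReal.ofReal lam * volume B * expNeg (ENNReal.ofReal lam * S.interferenceIntegral τ) := by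
    have hm : Measurable fun v => S.meanAttenuation τ v :=
      Params.measurable_meanAttenuation hgst hgpr hgsr τ
    have hpl : ∫⁻ u, (1 - S.meanAttenuation τ (S.placement ω u)) =
        ∫⁻ v, (1 - S.meanAttenuation τ v) :=
      (measurePreserving_placement ω).lintegral_comp (measurable_const.sub hm)
    rw [hnet.locations.palmProduct_translate hlam hB hB1
      (h := fun u => S.meanAttenuation τ (S.placement ω u))
      (hm.comp (measurePreserving_placement ω).measurable)
      fun u => Params.meanAttenuation_le_one _ _, hpl,
      lintegral_one_sub_meanAttenuation hτ hα hA0 hps hρ hgpr hgst hgsr]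
  have hσ : expNeg (ENNReal.ofReal (τ / S.A0) * ENNReal.ofReal (S.σ ^ 2)) =
      ENNReal.ofReal (Real.exp (-(τ * S.σ ^ 2 / S.A0))) := by
    rw [← ENNReal.ofReal_mul (by positivity), expNeg_ofReal (by positivity)]
    congr 3
    ring
  -- The mean number of points in `B` is positive and finite, so it cancels against the
  -- normalization of the Palm probability.
  have hmass : ENNReal.ofReal lam * volume B ≠ 0 :=
    mul_ne_zero (by simpa using hlam) hB0.ne'
  have hmass' : ENNReal.ofReal lam * volume B ≠ ⊤ :=
    (ENNReal.mul_lt_top ENNReal.ofReal_lt_top hB1).ne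
  rw [coverageProb, palmProb, hnet.lintegral_encard hgst hgpr hgsr hτ hA0 hB]
  simp_rw [hpalm]
  rw [lintegral_const, measure_univ, mul_one, hσ,
    linkFactor_eq hτ hA0 hpp hps hρ hxp hgpt hgpr hgst hgsr, ← mul_assoc, mul_right_comm,
    ENNReal.mul_div_cancel_right hmass hmass']
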